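/- Notation. Operators on $\mathbb{C}^d$ ($d\ge 1$) are ordered by the Löwner order: $A\le B$ iff $B-A$ is positive semi-definite (PSD). For $t\in[0,1]$ and PSD operators $A,B$ on a finite-dimensional Hilbert space, the $t$-weighted Kubo-Ando geometric mean is $$B\#_tA:=\lim_{\varepsilon\searrow 0}(B+\varepsilon I)^{1/2}\left((B+\varepsilon I)^{-1/2}(A+\varepsilon I)(B+\varepsilon I)^{-1/2}\right)^t(B+\varepsilon I)^{1/2}$$ (the limit always exists). A $2$-variable positive operator function $G$ is a function defined on a non-empty set $\mathrm{dom}(G)$ of pairs $(A_1,A_2)$ of PSD operators on the spaces $\mathbb{C}^d$, $d\ge 1$ (both members of a pair acting on the same $\mathbb{C}^d$), such that, for every $(A_1,A_2)\in\mathrm{dom}(G)$ on $\mathbb{C}^d$, $G(A_1,A_2)$ is a PSD operator on $\mathbb{C}^d$ and, for every unitary $V$ on $\mathbb{C}^d$, $(VA_1V^*,VA_2V^*)\in\mathrm{dom}(G)$ and $G(VA_1V^*,VA_2V^*)=VG(A_1,A_2)V^*$. By unitary covariance $G$ extends to pairs of PSD operators on finite-dimensional Hilbert spaces. $G$ is block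 superadditive if for all $r\ge 1$ and all pairs $(A_i,B_i)$, $i=1,\dots,r$, in its domain, $(\oplus_iA_i,\oplus_iB_i)$ is in its domain and $G(\oplus_iA_i,\oplus_iB_i)\ge\oplus_iG(A_i,B_i)$. $G$ is asymptotically individually AM bounded if for every $(A_1,A_2)\in\mathrm{dom}(G)$ there exist $p_n,q_n\in[0,+\infty)$, $n\ge 1$ (which may depend on $(A_1,A_2)$), such that $$G(A_1,A_2)^{\otimes n}\le p_nA_1^{\otimes n}+q_nA_2^{\otimes n}\quad(n\ge 1),\qquad \limsup_{n\to+\infty}\frac1n\log(p_n+q_n)\le 0,$$ where $\log 0:=-\infty$. For a probability measure $\nu$ on $\{1,2\}$, $G$ is a $\nu$-weighted operator geometric mean if every commuting pair $(A_1,A_2)$ of positive definite operators on any $\mathbb{C}^d$, $d\ge 1$, is in $\mathrm{dom}(G)$, and $G(A_1,A_2)=\exp(\nu(1)\log A_1+\nu(2)\log A_2)$ for every such pair. Theorem. Let $G$ be a $2$-variable positive operator function that is block superadditive and asymptotically individually AM bounded. Then there exists a $t\in[0,1]$ such that $$G(A_1,A_2)\le A_2\#_tA_1\qquad\text{for all }(A_1,A_2)\in\mathrm{dom}(G).$$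 If, moreover, $G$ is a $\nu$-weighted operator geometric mean for a probability measure $\nu$ on $\{1,2\}$, then this $t$ is unique and equal to $\nu(1)$; in particular, $G(A_1,A_2)\le A_2\#_{\nu(1)}A_1$ for all $(A_1,A_2)\in\mathrm{dom}(G)$. -/

import Mathlib

open scoped MatrixOrder ComplexOrder NNReal ENNReal Matrix
open Filter Topology

/-! ### The weighted Kubo-Ando geometric mean of positive semi-definite matrices

Operators on `ℂ^d` are written as `d × d` complex matrices; `≤` is the Löwner order
(`A ≤ B` iff `B - A` is positive semi-definite), and `X ^ s`, for positive semi-definite `X` and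
real `s`, is the power given by the functional calculus. -/

/-- `B^{1/2} (B^{-1/2} A B^{-1/2})^t B^{1/2}`, for positive definite `A`, `B`. -/
noncomputable def operatorPerspectiveRpow {ι : Type*} [Fintype ι] [DecidableEq ι] (t : ℝ)
    (A B : Matrix ι ι ℂ) : Matrix ι ι ℂ :=
  B ^ (1 / 2 : ℝ) * (B ^ (-1 / 2 : ℝ) * A * B ^ (-1 / 2 : ℝ)) ^ t * B ^ (1 / 2 : ℝ)

/-- The `t`-weighted Kubo-Ando geometric mean `B #_t A` of positive semi-definite `A`, `B`: the limit
of `(B + εI)^{1/2} ((B + εI)^{-1/2} (A + εI) (B + εI)^{-1/2})^t (B + εI)^{1/2}` as `ε ↘ 0`.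
For `t ∈ [0, 1]` this limit exists, see `tendsto_kuboAndoMean`. -/
noncomputable def kuboAndoMean {ι : Type*} [Fintype ι] [DecidableEq ι] (t : ℝ)
    (B A : Matrix ι ι ℂ) : Matrix ι ι ℂ :=
  limUnder (𝓝[>] (0 : ℝ)) fun ε : ℝ =>
    operatorPerspectiveRpow t (A + (ε : ℂ) • (1 : Matrix ι ι ℂ)) (B + (ε : ℂ) • (1 : Matrix ι ι ℂ))

/-! Proof that the limit in the definition of `kuboAndoMean` exists. -/

section Existence

variable {ι : Type*} [Fintype ι] [DecidableEq ι]

section CStar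

open scoped Matrix.Norms.L2Operator

theorem operatorPerspectiveRpow_mono_left {t : ℝ} (ht : t ∈ Set.Icc (0 : ℝ) 1)
    {A A' B : Matrix ι ι ℂ} (h : A ≤ A') :
    operatorPerspectiveRpow t A B ≤ operatorPerspectiveRpow t A' B := by
  have hc : ∀ (s : ℝ) {X Y : Matrix ι ι ℂ}, X ≤ Y → B ^ s * X * B ^ s ≤ B ^ s * Y * B ^ s := by
    intro s X Y hXY
    have hs : star (B ^ s) = B ^ s := (IsSelfAdjoint.of_nonneg CFC.rpow_nonneg).star_eq
    have := star_left_conjugate_le_conjugate hXY (B ^ s)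
    rwa [hs] at this
  exact hc _ (CFC.rpow_le_rpow ht (hc _ h))

theorem rpow_conj_unitary {U : Matrix ι ι ℂ} (hU : Uᴴ * U = 1) (hU' : U * Uᴴ = 1)
    {X : Matrix ι ι ℂ} (hX : X.PosDef) (s : ℝ) :
    (Uᴴ * X * U) ^ s = Uᴴ * X ^ s * U := by
  have hmem : Uᴴ ∈ unitary (Matrix ι ι ℂ) := by
    rw [Unitary.mem_iff, Matrix.star_eq_conjTranspose, Matrix.conjTranspose_conjTranspose]
    exact ⟨hU', hU⟩
  have hX0 : 0 ≤ X := hX.posSemidef.nonneg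
  have hUX : 0 ≤ Uᴴ * X * U := (hX.posSemidef.conjTranspose_mul_mul_same U).nonneg
  have h := StarAlgHomClass.map_cfc (S := ℝ) (R := ℝ)
    (Unitary.conjStarAlgAut ℝ (Matrix ι ι ℂ) ⟨Uᴴ, hmem⟩) (fun x : ℝ => x ^ s) X
    (Set.Finite.continuousOn (Matrix.finite_real_spectrum) _)
    (by
      have : Continuous fun x : Matrix ι ι ℂ => Uᴴ * x * star Uᴴ := by fun_prop
      exact this)
    hX.isHermitian.isSelfAdjoint
    (by
      simp only [Unitary.conjStarAlgAut_apply]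
      exact IsSelfAdjoint.conjugate hX.isHermitian.isSelfAdjoint _)
  simp only [Unitary.conjStarAlgAut_apply, Matrix.star_eq_conjTranspose,
    Matrix.conjTranspose_conjTranspose] at h
  rw [CFC.rpow_eq_cfc_real, CFC.rpow_eq_cfc_real]
  exact h.symm

end CStar

theorem operatorPerspectiveRpow_swap (t : ℝ) {A B : Matrix ι ι ℂ} (hA : A.PosDef) (hB : B.PosDef) :
    operatorPerspectiveRpow t A B = operatorPerspectiveRpow (1 - t) B A := by
  have key : ∀ {X : Matrix ι ι ℂ} (hX : X.PosDef) (r s : ℝ), X ^ r * X ^ s = X ^ (r + s) :=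
    fun hX r s => (CFC.rpow_add hX.isUnit).symm
  have hH : ∀ (X : Matrix ι ι ℂ) (s : ℝ), (X ^ s)ᴴ = X ^ s := fun X s =>
    (IsSelfAdjoint.of_nonneg (CFC.rpow_nonneg (a := X) (y := s))).star_eq
  have h1 : ∀ {X : Matrix ι ι ℂ} (hX : X.PosDef), X ^ (1 / 2 : ℝ) * X ^ (-1 / 2 : ℝ) = 1 := by
    intro X hX
    rw [key hX, show (1 / 2 + -1 / 2 : ℝ) = 0 by norm_num, CFC.rpow_zero X hX.posSemidef.nonneg]
  have h2 : ∀ {X : Matrix ι ι ℂ} (hX : X.PosDef), X ^ (-1 / 2 : ℝ) * X ^ (1 / 2 : ℝ) = 1 :=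
    fun hX => mul_eq_one_comm.mp (h1 hX)
  have h3 : ∀ {X : Matrix ι ι ℂ} (hX : X.PosDef), X ^ (1 / 2 : ℝ) * X ^ (1 / 2 : ℝ) = X := by
    intro X hX
    rw [key hX, show (1 / 2 + 1 / 2 : ℝ) = 1 by norm_num, CFC.rpow_one X hX.posSemidef.nonneg]
  unfold operatorPerspectiveRpow
  have hC : (B ^ (-1 / 2 : ℝ) * A * B ^ (-1 / 2 : ℝ)).PosDef := by
    have hps : (B ^ (-1 / 2 : ℝ) * A * B ^ (-1 / 2 : ℝ)).PosSemidef := by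
      have := hA.posSemidef.conjTranspose_mul_mul_same (B ^ (-1 / 2 : ℝ))
      rwa [hH] at this
    rw [hps.posDef_iff_isUnit]
    have hb : IsUnit (B ^ (-1 / 2 : ℝ)) := .of_mul_eq_one _ (h2 hB)
    exact (hb.mul hA.isUnit).mul hb
  set C := B ^ (-1 / 2 : ℝ) * A * B ^ (-1 / 2 : ℝ) with hCdef
  set b := B ^ (1 / 2 : ℝ) with hb
  set b' := B ^ (-1 / 2 : ℝ) with hb'
  set a := A ^ (1 / 2 : ℝ) with ha
  set a' := A ^ (-1 / 2 : ℝ) with ha'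
  set c := C ^ (1 / 2 : ℝ) with hc
  set c' := C ^ (-1 / 2 : ℝ) with hc'
  have bb' : b * b' = 1 := h1 hB
  have b'b : b' * b = 1 := h2 hB
  have aa' : a * a' = 1 := h1 hA
  have a'a : a' * a = 1 := h2 hA
  have cc' : c * c' = 1 := h1 hC
  have c'c : c' * c = 1 := h2 hC
  have aa : a * a = A := h3 hA
  have bB : b * b = B := h3 hB
  have ccC : c * c = C := h3 hC
  let U := c' * b' * a
  have hUH : Uᴴ = a * b' * c' := by
    simp only [U, Matrix.conjTranspose_mul, ha, hb', hc', hH, mul_assoc]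
  have hU' : U * Uᴴ = 1 := by
    calc U * Uᴴ = c' * (b' * (a * a) * b') * c' := by rw [hUH]; simp only [U, mul_assoc]
      _ = c' * (c * c) * c' := by rw [aa, ← hCdef, ccC]
      _ = (c' * c) * (c * c') := by simp only [mul_assoc]
      _ = 1 := by rw [c'c, cc', one_mul]
  have hU : Uᴴ * U = 1 := mul_eq_one_comm.mp hU'
  have ha1 : a = b * c * U := by
    calc a = b * (c * c') * b' * a := by rw [cc', mul_one, bb', one_mul]
      _ = _ := by simp only [U, mul_assoc]
  have ha2 : a = Uᴴ * (c * b) := by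
    calc a = a * (b' * (c' * c) * b) := by rw [c'c, mul_one, b'b, mul_one]
      _ = _ := by rw [hUH]; simp only [mul_assoc]
  have ha'1 : a' = Uᴴ * (c' * b') := by
    calc a' = Uᴴ * U * a' := by rw [hU, one_mul]
      _ = Uᴴ * (c' * b') * (a * a') := by simp only [U, mul_assoc]
      _ = _ := by rw [aa', mul_one]
  have ha'2 : a' = b' * c' * U := by
    calc a' = a' * (Uᴴ * U) := by rw [hU, mul_one]
      _ = (a' * a) * (b' * c') * U := by rw [hUH]; simp only [mul_assoc]
      _ = _ := by rw [a'a, one_mul]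
  have hmid : a' * B * a' = Uᴴ * C ^ (-1 : ℝ) * U := by
    calc a' * B * a' = (Uᴴ * (c' * b')) * (b * b) * (b' * c' * U) := by
          rw [bB, ← ha'1, ← ha'2]
      _ = Uᴴ * (c' * ((b' * b) * (b * b')) * c') * U := by simp only [mul_assoc]
      _ = _ := by
        rw [b'b, bb', one_mul, mul_one, hc', key hC]
        norm_num
  have hCinv : (C ^ (-1 : ℝ)).PosDef := by
    rw [(Matrix.nonneg_iff_posSemidef.mp (CFC.rpow_nonneg (a := C))).posDef_iff_isUnit]
    exact hC.isUnit.cfcRpow _ hC.posSemidef.nonneg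
  have hpow : (C ^ (-1 : ℝ)) ^ (1 - t) = C ^ (t - 1) := by
    rw [CFC.rpow_rpow C _ _ (by norm_num) (hC.isUnit.isStrictlyPositive hC.posSemidef.nonneg)]
    congr 1; ring
  rw [hmid, rpow_conj_unitary hU hU' hCinv, hpow]
  symm
  calc a * (Uᴴ * C ^ (t - 1) * U) * a
      = (b * c * U) * (Uᴴ * C ^ (t - 1) * U) * (Uᴴ * (c * b)) := by rw [← ha1, ← ha2]
    _ = b * c * (U * Uᴴ) * C ^ (t - 1) * (U * Uᴴ) * c * b := by simp only [mul_assoc]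
    _ = b * (c * C ^ (t - 1) * c) * b := by rw [hU']; simp only [mul_one, mul_assoc]
    _ = b * C ^ t * b := by
      rw [hc, key hC, key hC]
      congr 3; ring

theorem operatorPerspectiveRpow_mono {t : ℝ} (ht : t ∈ Set.Icc (0 : ℝ) 1)
    {A A' B B' : Matrix ι ι ℂ} (hA' : A'.PosDef) (hB : B.PosDef) (hB' : B'.PosDef)
    (h : A ≤ A') (hBB : B ≤ B') :
    operatorPerspectiveRpow t A B ≤ operatorPerspectiveRpow t A' B' := by
  refine (operatorPerspectiveRpow_mono_left ht h).trans ?_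
  rw [operatorPerspectiveRpow_swap t hA' hB, operatorPerspectiveRpow_swap t hA' hB']
  exact operatorPerspectiveRpow_mono_left ⟨by linarith [ht.2], by linarith [ht.1]⟩ hBB

theorem operatorPerspectiveRpow_nonneg (t : ℝ) (A B : Matrix ι ι ℂ) :
    0 ≤ operatorPerspectiveRpow t A B := by
  have hs : star (B ^ (1 / 2 : ℝ)) = B ^ (1 / 2 : ℝ) :=
    (IsSelfAdjoint.of_nonneg CFC.rpow_nonneg).star_eq
  have := star_left_conjugate_nonneg
    (CFC.rpow_nonneg (a := B ^ (-1 / 2 : ℝ) * A * B ^ (-1 / 2 : ℝ)) (y := t)) (B ^ (1 / 2 : ℝ))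
  rwa [hs] at this

/-- A monotone family of positive semidefinite matrices converges as the parameter decreases to
`0`. -/
theorem exists_tendsto_of_monotoneOn {F : ℝ → Matrix ι ι ℂ} (hF : MonotoneOn F (Set.Ioi 0))
    (h0 : ∀ ε, 0 ≤ F ε) : ∃ L, Tendsto F (𝓝[>] 0) (𝓝 L) := by
  have hq : ∀ x : ι → ℂ, ∃ l : ℂ, Tendsto (fun ε => star x ⬝ᵥ F ε *ᵥ x) (𝓝[>] 0) (𝓝 l) := by
    intro x
    have hnn : ∀ ε, 0 ≤ star x ⬝ᵥ F ε *ᵥ x := fun ε => (Matrix.nonneg_iff_posSemidef.mp (h0 ε)).dotProduct_mulVec_nonneg x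
    have hmono : MonotoneOn (fun ε => (star x ⬝ᵥ F ε *ᵥ x).re) (Set.Ioi 0) := by
      intro u hu v hv huv
      have := (Matrix.le_iff.mp (hF hu hv huv)).dotProduct_mulVec_nonneg x
      rw [Matrix.sub_mulVec, dotProduct_sub] at this
      have h := (Complex.le_def.mp this).1
      simp only [Complex.zero_re, Complex.sub_re] at h
      simpa using h
    have hbdd : BddBelow ((fun ε => (star x ⬝ᵥ F ε *ᵥ x).re) '' Set.Ioi 0) :=
      ⟨0, by rintro _ ⟨ε, -, rfl⟩; exact (Complex.le_def.mp (hnn ε)).1⟩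
    have := hmono.tendsto_nhdsGT hbdd
    refine ⟨_, ((Complex.continuous_ofReal.tendsto _).comp this).congr fun ε => ?_⟩
    exact Complex.ext (by simp) (by simpa using (Complex.le_def.mp (hnn ε)).2)
  have hent : ∀ i j, ∃ l : ℂ, Tendsto (fun ε => F ε i j) (𝓝[>] 0) (𝓝 l) := by
    intro i j
    choose q hq using hq
    let e : ι → ι → ℂ := fun i => Pi.single i 1
    have hpol : ∀ M : Matrix ι ι ℂ, M i j = (1 / 4 : ℂ) *
        ((star (e i + e j) ⬝ᵥ M *ᵥ (e i + e j)) - (star (e i - e j) ⬝ᵥ M *ᵥ (e i - e j))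
        - Complex.I * (star (e i + Complex.I • e j) ⬝ᵥ M *ᵥ (e i + Complex.I • e j))
        + Complex.I * (star (e i - Complex.I • e j) ⬝ᵥ M *ᵥ (e i - Complex.I • e j))) := by
      intro M
      have he : ∀ k l, star (e k) ⬝ᵥ M *ᵥ e l = M k l := by
        intro k l
        simp [e]
      simp only [star_add, star_sub, star_smul, Matrix.mulVec_add, Matrix.mulVec_sub,
        Matrix.mulVec_smul, dotProduct_add, dotProduct_sub, add_dotProduct, sub_dotProduct,
        smul_dotProduct, dotProduct_smul, he, smul_eq_mul, Complex.star_def, Complex.conj_I]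
      linear_combination (1 / 2 * (M i j - M j i)) * Complex.I_sq
    exact ⟨_, Tendsto.congr (fun ε => (hpol (F ε)).symm)
      (((((hq (e i + e j)).sub (hq (e i - e j))).sub
        ((hq (e i + Complex.I • e j)).const_mul Complex.I)).add
        ((hq (e i - Complex.I • e j)).const_mul Complex.I)).const_mul (1 / 4 : ℂ))⟩
  choose l hl using hent
  exact ⟨Matrix.of l, tendsto_pi_nhds.mpr fun i => tendsto_pi_nhds.mpr fun j => hl i j⟩

theorem tendsto_kuboAndoMean {t : ℝ} (ht : t ∈ Set.Icc (0 : ℝ) 1) {A B : Matrix ι ι ℂ}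
    (hA : A.PosSemidef) (hB : B.PosSemidef) :
    Tendsto (fun ε : ℝ => operatorPerspectiveRpow t (A + (ε : ℂ) • (1 : Matrix ι ι ℂ))
      (B + (ε : ℂ) • (1 : Matrix ι ι ℂ))) (𝓝[>] 0) (𝓝 (kuboAndoMean t B A)) := by
  have hpd : ∀ {X : Matrix ι ι ℂ}, X.PosSemidef → ∀ ε : ℝ, 0 < ε →
      (X + (ε : ℂ) • (1 : Matrix ι ι ℂ)).PosDef := fun hX ε hε =>
    (Matrix.PosDef.one.smul (by exact_mod_cast hε : (0 : ℂ) < ε)).posSemidef_add hX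
  have hle : ∀ (X : Matrix ι ι ℂ) {u v : ℝ}, u ≤ v →
      X + (u : ℂ) • (1 : Matrix ι ι ℂ) ≤ X + (v : ℂ) • (1 : Matrix ι ι ℂ) := by
    intro X u v huv
    rw [Matrix.le_iff, add_sub_add_left_eq_sub, ← sub_smul]
    exact Matrix.PosSemidef.one.smul (by exact_mod_cast sub_nonneg.mpr huv)
  obtain ⟨L, hL⟩ := exists_tendsto_of_monotoneOn
    (F := fun ε : ℝ => operatorPerspectiveRpow t (A + (ε : ℂ) • (1 : Matrix ι ι ℂ))
      (B + (ε : ℂ) • (1 : Matrix ι ι ℂ)))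
    (fun u hu v hv huv => operatorPerspectiveRpow_mono ht (hpd hA v hv) (hpd hB u hu)
      (hpd hB v hv) (hle A huv) (hle B huv))
    (fun ε => operatorPerspectiveRpow_nonneg _ _ _)
  exact tendsto_nhds_limUnder ⟨L, hL⟩

end Existence

/-! ### Two-variable positive operator functions -/

/-- A `2`-variable positive operator function: a function `val` on a non-empty set
`dom = ⋃_{d ≥ 1} dom d` of pairs of positive semi-definite operators on the spaces `ℂ^d`, mapping
pairs of operators on `ℂ^d` to positive semi-definite operators on `ℂ^d`, covariant under unitaries.
The values of `val` outside of the domain are irrelevant. -/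
structure PositiveOperatorFunction where
  dom : ∀ d : ℕ, Set (Matrix (Fin d) (Fin d) ℂ × Matrix (Fin d) (Fin d) ℂ)
  val : ∀ {d : ℕ}, Matrix (Fin d) (Fin d) ℂ → Matrix (Fin d) (Fin d) ℂ → Matrix (Fin d) (Fin d) ℂ
  dom_nonempty : ∃ d, (dom d).Nonempty
  dim_pos : ∀ {d : ℕ}, (dom d).Nonempty → 0 < d
  posSemidef_of_mem : ∀ {d : ℕ} {A₁ A₂ : Matrix (Fin d) (Fin d) ℂ}, (A₁, A₂) ∈ dom d →
    A₁.PosSemidef ∧ A₂.PosSemidef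
  posSemidef_val : ∀ {d : ℕ} {A₁ A₂ : Matrix (Fin d) (Fin d) ℂ}, (A₁, A₂) ∈ dom d →
    (val A₁ A₂).PosSemidef
  unitary_covariant : ∀ {d : ℕ} {A₁ A₂ : Matrix (Fin d) (Fin d) ℂ}, (A₁, A₂) ∈ dom d →
    ∀ V ∈ Matrix.unitaryGroup (Fin d) ℂ,
      (V * A₁ * Vᴴ, V * A₂ * Vᴴ) ∈ dom d ∧ val (V * A₁ * Vᴴ) (V * A₂ * Vᴴ) = V * val A₁ A₂ * Vᴴ

/-- The direct sum `⨁_i A_i` on `⨁_i ℂ^{d_i} ≅ ℂ^{∑_i d_i}`, a block diagonal matrix. For unitarily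
covariant functions the choice of the identification of the two spaces is immaterial. -/
def matrixDirectSum {r : ℕ} {d : Fin r → ℕ} (A : ∀ i, Matrix (Fin (d i)) (Fin (d i)) ℂ) :
    Matrix (Fin (∑ i, d i)) (Fin (∑ i, d i)) ℂ :=
  (Matrix.blockDiagonal' A).reindex finSigmaFinEquiv finSigmaFinEquiv

/-- The tensor power `A^{⊗ n}`, a matrix in the product basis of `(ℂ^d)^{⊗ n}`. -/
def matrixTensorPower (n : ℕ) {d : ℕ} (A : Matrix (Fin d) (Fin d) ℂ) :
    Matrix (Fin n → Fin d) (Fin n → Fin d) ℂ :=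
  Matrix.of fun x y => ∏ k, A (x k) (y k)

namespace PositiveOperatorFunction

/-- Block superadditivity: the domain is closed under direct sums, and
`G(⨁ A_i, ⨁ B_i) ≥ ⨁ G(A_i, B_i)`. -/
def BlockSuperadditive (G : PositiveOperatorFunction) : Prop :=
  ∀ (r : ℕ), 0 < r → ∀ (d : Fin r → ℕ) (A B : ∀ i, Matrix (Fin (d i)) (Fin (d i)) ℂ),
    (∀ i, (A i, B i) ∈ G.dom (d i)) →
      (matrixDirectSum A, matrixDirectSum B) ∈ G.dom (∑ i, d i) ∧
      matrixDirectSum (fun i => G.val (A i) (B i)) ≤ G.val (matrixDirectSum A) (matrixDirectSum B)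

/-- Asymptotic individual arithmetic mean boundedness: for each pair in the domain there are measures
`μ_n` on `{1, 2}`, given by their point masses `p n = μ_n {1}` and `q n = μ_n {2}`, such that
`G(A₁, A₂)^{⊗ n} ≤ p n A₁^{⊗ n} + q n A₂^{⊗ n}` and `limsup_n (1 / n) log (p n + q n) ≤ 0`.
Here `log 0 = -∞`. -/
def AsymptoticallyIndividuallyAMBounded (G : PositiveOperatorFunction) : Prop :=
  ∀ (d : ℕ) (A₁ A₂ : Matrix (Fin d) (Fin d) ℂ), (A₁, A₂) ∈ G.dom d →
    ∃ p q : ℕ → ℝ≥0,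
      (∀ n : ℕ, 0 < n → matrixTensorPower n (G.val A₁ A₂) ≤
        ((p n : ℝ) : ℂ) • matrixTensorPower n A₁ + ((q n : ℝ) : ℂ) • matrixTensorPower n A₂) ∧
      limsup (fun n : ℕ => ENNReal.log ((p n + q n : ℝ≥0) : ℝ≥0∞) / ((n : ℝ) : EReal)) atTop ≤ 0

/-- `G` is a `ν`-weighted operator geometric mean, where `ν` is the probability measure on `{1, 2}`
with `ν {1} = ν₁` and `ν {2} = ν₂`: each commuting pair of positive definite operators is in the
domain, and there `G(A₁, A₂) = exp (ν₁ log A₁ + ν₂ log A₂)`. -/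
def IsWeightedGeometricMean (G : PositiveOperatorFunction) (ν₁ ν₂ : ℝ) : Prop :=
  ∀ (d : ℕ), 0 < d → ∀ A₁ A₂ : Matrix (Fin d) (Fin d) ℂ, A₁.PosDef → A₂.PosDef → Commute A₁ A₂ →
    (A₁, A₂) ∈ G.dom d ∧
      G.val A₁ A₂ =
        NormedSpace.exp ((ν₁ : ℂ) • cfc Real.log A₁ + (ν₂ : ℂ) • cfc Real.log A₂)

/-- `G(A₁, A₂) ≤ A₂ #_t A₁` on the whole domain of `G`. -/
def LeKuboAndo (G : PositiveOperatorFunction) (t : ℝ) : Prop :=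
  ∀ (d : ℕ) (A₁ A₂ : Matrix (Fin d) (Fin d) ℂ), (A₁, A₂) ∈ G.dom d →
    G.val A₁ A₂ ≤ kuboAndoMean t A₂ A₁

end PositiveOperatorFunction

/-! ### Sums over product spaces -/

/-! For a positive definite pair, a congruence turns `A₂` into the identity, `A₁` into diag(e^x) and
the means into diag(e^{tx}), and it preserves the tensor bounds. The task is thus to find t with K ≤
diag(e^{tx}), where K is the transformed value of G (`exists_le_diagonal_exp`).

Write K = L*L. If every t in [0,1] fails, duality gives for each t a vector v such that u = L*v
satisfies ∑ e^{-t x_i}|u_i|² > |v|². Connectedness of [0,1] interchanges the quantifiers: one such v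
exceeds its norm even at a t minimising this sum, which is convex in t
(`exists_stationary_of_forall_exists`). Scale to |v| = 1, so that uu* ≤ K, and let Φ > 1 be the sum.
Testing the n-th tensor bound gives Φ^n E[e^{-|S_n|}] ≤ p_n + q_n, where S_n is a sum of n centred
i.i.d. variables. Chebyshev's inequality shows that the expectation costs less than any exponential
rate, so Φ > 1 contradicts subexponential growth (`sum_exp_mul_norm_sq_le_one`).

Singular pairs follow by adding ε and using compactness of [0,1]. A common t for all pairs comes
from the finite intersection property: an exponent valid for a direct sum is valid for every summand
(`exists_leKuboAndo`). Scalar pairs then identify t with ν(1). -/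

theorem sum_fin_succ_pi {ι M : Type*} [Fintype ι] [AddCommMonoid M] (n : ℕ)
    (f : (Fin (n + 1) → ι) → M) :
    ∑ z, f z = ∑ i, ∑ z : Fin n → ι, f (Fin.cons i z) := by
  rw [← Fintype.sum_prod_type' (f := fun i (z : Fin n → ι) => f (Fin.cons i z))]
  exact (Fintype.sum_equiv (Fin.consEquiv fun _ => ι) _ _ fun z => rfl).symm

theorem sum_prod_pi_eq_one {ι : Type*} [Fintype ι] {c : ι → ℝ} (hc : ∑ i, c i = 1) (n : ℕ) :
    ∑ z : Fin n → ι, ∏ k, c (z k) = 1 := by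
  induction n with
  | zero => simp
  | succ n ih => simp [sum_fin_succ_pi, Fin.prod_univ_succ, ← Finset.mul_sum, ih, hc]

theorem sum_prod_pi_mul_sum_eq_zero {ι : Type*} [Fintype ι] {c s : ι → ℝ} (hc : ∑ i, c i = 1)
    (hs : ∑ i, c i * s i = 0) (n : ℕ) :
    ∑ z : Fin n → ι, (∏ k, c (z k)) * ∑ k, s (z k) = 0 := by
  induction n with
  | zero => simp
  | succ n ih =>
    have h : ∀ i, ∑ z : Fin n → ι, c i * (∏ k, c (z k)) * (s i + ∑ k, s (z k)) = c i * s i := by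
      intro i
      calc _ = c i * s i * (∑ z : Fin n → ι, ∏ k, c (z k))
            + c i * ∑ z : Fin n → ι, (∏ k, c (z k)) * ∑ k, s (z k) := by
            rw [Finset.mul_sum, Finset.mul_sum, ← Finset.sum_add_distrib]
            exact Finset.sum_congr rfl fun z _ => by ring
        _ = _ := by rw [ih, sum_prod_pi_eq_one hc]; ring
    simp [sum_fin_succ_pi, Fin.prod_univ_succ, Fin.sum_univ_succ, h, hs]

/-- The variance of a sum of independent centred random variables. -/
theorem sum_prod_pi_mul_sum_sq {ι : Type*} [Fintype ι] {c s : ι → ℝ} (hc : ∑ i, c i = 1)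
    (hs : ∑ i, c i * s i = 0) (n : ℕ) :
    ∑ z : Fin n → ι, (∏ k, c (z k)) * (∑ k, s (z k)) ^ 2 = n * ∑ i, c i * s i ^ 2 := by
  induction n with
  | zero => simp
  | succ n ih =>
    have h : ∀ i, ∑ z : Fin n → ι, c i * (∏ k, c (z k)) * (s i + ∑ k, s (z k)) ^ 2
        = c i * s i ^ 2 + c i * (n * ∑ i, c i * s i ^ 2) := by
      intro i
      calc _ = c i * s i ^ 2 * (∑ z : Fin n → ι, ∏ k, c (z k))
            + 2 * c i * s i * (∑ z : Fin n → ι, (∏ k, c (z k)) * ∑ k, s (z k))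
            + c i * ∑ z : Fin n → ι, (∏ k, c (z k)) * (∑ k, s (z k)) ^ 2 := by
            rw [Finset.mul_sum, Finset.mul_sum, Finset.mul_sum, ← Finset.sum_add_distrib,
              ← Finset.sum_add_distrib]
            exact Finset.sum_congr rfl fun z _ => by ring
        _ = _ := by rw [ih, sum_prod_pi_eq_one hc, sum_prod_pi_mul_sum_eq_zero hc hs]; ring
    simp only [sum_fin_succ_pi, Fin.prod_univ_succ, Fin.sum_univ_succ, Fin.cons_zero,
      Fin.cons_succ, h]
    rw [Finset.sum_add_distrib, ← Finset.sum_mul, hc]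
    push_cast; ring

/-- Pointwise Chebyshev: 1 - y²/r² is at most 1 where |y| ≤ r and nonpositive elsewhere. -/
theorem exp_neg_abs_ge {r : ℝ} (hr : 0 < r) (y : ℝ) :
    Real.exp (-r) * (1 - y ^ 2 / r ^ 2) ≤ Real.exp (-|y|) := by
  rcases le_total |y| r with h | h
  · calc Real.exp (-r) * (1 - y ^ 2 / r ^ 2) ≤ Real.exp (-r) * 1 := by
          gcongr
          have : 0 ≤ y ^ 2 / r ^ 2 := by positivity
          linarith
      _ ≤ _ := by rw [mul_one]; gcongr
  · have : 1 ≤ y ^ 2 / r ^ 2 := by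
      rw [one_le_div (by positivity), ← sq_abs y]
      gcongr
    have h2 : Real.exp (-r) * (1 - y ^ 2 / r ^ 2) ≤ 0 :=
      mul_nonpos_of_nonneg_of_nonpos (Real.exp_nonneg _) (by linarith)
    exact h2.trans (Real.exp_nonneg _)

theorem sum_prod_pi_mul_exp_neg_abs_ge {ι : Type*} [Fintype ι] {c s : ι → ℝ} (hc0 : ∀ i, 0 ≤ c i)
    (hc : ∑ i, c i = 1) (hs : ∑ i, c i * s i = 0) (n : ℕ) {r : ℝ} (hr : 0 < r) :
    Real.exp (-r) * (1 - n * (∑ i, c i * s i ^ 2) / r ^ 2) ≤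
      ∑ z : Fin n → ι, (∏ k, c (z k)) * Real.exp (-|∑ k, s (z k)|) := by
  rw [← sum_prod_pi_mul_sum_sq hc hs n]
  calc _ = ∑ z : Fin n → ι, (∏ k, c (z k)) * (Real.exp (-r) * (1 - (∑ k, s (z k)) ^ 2 / r ^ 2)) := by
        have := sum_prod_pi_eq_one hc n
        calc _ = Real.exp (-r) * ((∑ z : Fin n → ι, ∏ k, c (z k)) -
              (∑ z : Fin n → ι, (∏ k, c (z k)) * (∑ k, s (z k)) ^ 2) / r ^ 2) := by rw [this]
          _ = _ := by
            rw [Finset.sum_div, ← Finset.sum_sub_distrib, Finset.mul_sum]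
            exact Finset.sum_congr rfl fun z _ => by ring
    _ ≤ _ := Finset.sum_le_sum fun z _ =>
        mul_le_mul_of_nonneg_left (exp_neg_abs_ge hr _) (Finset.prod_nonneg fun k _ => hc0 _)

/-! ### Real quadratic forms -/

/-- If two real quadratic forms `Q₁`, `Q₂` are such that `Q₁` is positive at `a` and `b`, while `Q₂`
changes sign between `a` and `b`, then `Q₂` vanishes somewhere on the cone where `Q₁` is positive. -/
theorem exists_pos_and_eq_zero_of_quadratic {E : Type*} [AddCommGroup E] [Module ℝ E]
    {Q₁ Q₂ : E → ℝ} {B₁ B₂ : E → E → ℝ}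
    (h₁ : ∀ (s r : ℝ) a b, Q₁ (s • a + r • b) = s ^ 2 * Q₁ a + r ^ 2 * Q₁ b + s * r * B₁ a b)
    (h₂ : ∀ (s r : ℝ) a b, Q₂ (s • a + r • b) = s ^ 2 * Q₂ a + r ^ 2 * Q₂ b + s * r * B₂ a b)
    {a b : E} (ha₁ : 0 < Q₁ a) (hb₁ : 0 < Q₁ b) (ha₂ : 0 < Q₂ a) (hb₂ : Q₂ b < 0) :
    ∃ v, 0 < Q₁ v ∧ Q₂ v = 0 := by
  -- Replacing b by -b changes neither form at b, so the sign can be chosen to make the cross term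
  -- of Q₁ nonnegative. Then Q₁ stays positive along the whole segment, and the intermediate value
  -- theorem applies to Q₂.
  obtain ⟨σ, hσ, hB⟩ : ∃ σ : ℝ, σ ^ 2 = 1 ∧ 0 ≤ σ * B₁ a b := by
    rcases le_total 0 (B₁ a b) with h | h
    · exact ⟨1, by norm_num, by simpa⟩
    · exact ⟨-1, by norm_num, by simpa⟩
  have hcont : ContinuousOn (fun s : ℝ => Q₂ ((1 - s) • a + (s * σ) • b)) (Set.Icc 0 1) := by
    simp only [h₂]
    fun_prop
  have hmem : (0 : ℝ) ∈ (fun s : ℝ => Q₂ ((1 - s) • a + (s * σ) • b)) '' Set.Icc 0 1 := by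
    refine intermediate_value_Icc' zero_le_one hcont ⟨?_, ?_⟩
    · simp only [h₂, mul_pow, hσ]
      simpa using hb₂.le
    · simp only [h₂]
      simpa using ha₂.le
  obtain ⟨s, ⟨hs0, hs1⟩, hs⟩ := hmem
  refine ⟨_, ?_, hs⟩
  rw [h₁, mul_pow, hσ]
  have h3 : 0 ≤ (1 - s) * s * (σ * B₁ a b) :=
    mul_nonneg (mul_nonneg (by linarith) hs0) hB
  have h4 : 0 < (1 - s) ^ 2 * Q₁ a + s ^ 2 * Q₁ b := by
    rcases eq_or_lt_of_le hs0 with rfl | h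
    · simpa
    · have : 0 < s ^ 2 * Q₁ b := by positivity
      have : 0 ≤ (1 - s) ^ 2 * Q₁ a := by positivity
      linarith
  nlinarith

/-- Puts weighted sums of squared moduli into the polarised form that
`exists_pos_and_eq_zero_of_quadratic` expects. -/
theorem sum_mul_norm_sq_comb {ι : Type*} [Fintype ι] (c : ι → ℝ) (s r : ℝ) (a b : ι → ℂ) :
    ∑ i, c i * ‖(s • a + r • b) i‖ ^ 2 = s ^ 2 * ∑ i, c i * ‖a i‖ ^ 2 + r ^ 2 * ∑ i, c i * ‖b i‖ ^ 2
      + s * r * ∑ i, c i * (2 * (a i * star (b i)).re) := by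
  simp only [Finset.mul_sum]
  rw [← Finset.sum_add_distrib, ← Finset.sum_add_distrib]
  refine Finset.sum_congr rfl fun i _ => ?_
  simp only [← Complex.normSq_eq_norm_sq, Complex.normSq_apply]
  simp
  ring

theorem norm_star_dotProduct_sq_le {ι : Type*} [Fintype ι] (a b : ι → ℂ) :
    ‖star a ⬝ᵥ b‖ ^ 2 ≤ (∑ i, ‖a i‖ ^ 2) * ∑ i, ‖b i‖ ^ 2 := by
  refine le_trans ?_ (Finset.sum_mul_sq_le_sq_mul_sq _ _ _)
  gcongr
  refine (norm_sum_le _ _).trans (le_of_eq ?_)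
  simp

/-! ### Tensor powers -/

section TensorPower

variable {d : ℕ}

theorem matrixTensorPower_mul (n : ℕ) (A B : Matrix (Fin d) (Fin d) ℂ) :
    matrixTensorPower n (A * B) = matrixTensorPower n A * matrixTensorPower n B := by
  ext x y
  simp only [matrixTensorPower, Matrix.of_apply, Matrix.mul_apply, Fintype.prod_sum,
    Finset.prod_mul_distrib]

theorem matrixTensorPower_conjTranspose (n : ℕ) (A : Matrix (Fin d) (Fin d) ℂ) :
    matrixTensorPower n Aᴴ = (matrixTensorPower n A)ᴴ := by
  ext x y
  simp [matrixTensorPower]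

theorem matrixTensorPower_diagonal (n : ℕ) (x : Fin d → ℂ) :
    matrixTensorPower n (Matrix.diagonal x) = Matrix.diagonal fun z : Fin n → Fin d => ∏ k, x (z k) := by
  ext z w
  simp only [matrixTensorPower, Matrix.of_apply, Matrix.diagonal_apply]
  split_ifs with h
  · simp [h]
  · obtain ⟨k, hk⟩ := Function.ne_iff.mp h
    exact Finset.prod_eq_zero (Finset.mem_univ k) (by simp [hk])

theorem matrixTensorPower_one (n : ℕ) :
    matrixTensorPower n (1 : Matrix (Fin d) (Fin d) ℂ) = 1 := by
  rw [← Matrix.diagonal_one, matrixTensorPower_diagonal]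
  simp

theorem matrixTensorPower_vecMulVec (n : ℕ) (u : Fin d → ℂ) :
    matrixTensorPower n (Matrix.vecMulVec u (star u)) =
      Matrix.vecMulVec (fun z : Fin n → Fin d => ∏ k, u (z k)) (star fun z => ∏ k, u (z k)) := by
  ext z w
  simp [matrixTensorPower, Matrix.vecMulVec_apply, Finset.prod_mul_distrib]

theorem matrixTensorPower_succ (n : ℕ) (A : Matrix (Fin d) (Fin d) ℂ) :
    matrixTensorPower (n + 1) A = (Matrix.kronecker A (matrixTensorPower n A)).submatrix
      (Fin.consEquiv fun _ => Fin d).symm (Fin.consEquiv fun _ => Fin d).symm := by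
  ext x y
  simp [matrixTensorPower, Fin.prod_univ_succ, Fin.consEquiv, Fin.tail]

theorem matrixTensorPower_nonneg (n : ℕ) {A : Matrix (Fin d) (Fin d) ℂ} (hA : 0 ≤ A) :
    0 ≤ matrixTensorPower n A := by
  rw [Matrix.nonneg_iff_posSemidef] at *
  induction n with
  | zero =>
    have : matrixTensorPower 0 A = 1 := by
      ext x y; obtain rfl := Subsingleton.elim x y; simp [matrixTensorPower]
    rw [this]
    exact Matrix.PosSemidef.one
  | succ n ih =>
    rw [matrixTensorPower_succ]
    exact (hA.kronecker ih).submatrix _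

theorem matrixTensorPower_mono (n : ℕ) {A B : Matrix (Fin d) (Fin d) ℂ} (hA : 0 ≤ A) (h : A ≤ B) :
    matrixTensorPower n A ≤ matrixTensorPower n B := by
  induction n with
  | zero => exact le_of_eq (by ext x y; simp [matrixTensorPower])
  | succ n ih =>
    have h1 := (Matrix.le_iff.mp h).kronecker
      (Matrix.nonneg_iff_posSemidef.mp (matrixTensorPower_nonneg n (hA.trans h)))
    have h2 := (Matrix.nonneg_iff_posSemidef.mp hA).kronecker (Matrix.le_iff.mp ih)
    rw [Matrix.le_iff, matrixTensorPower_succ, matrixTensorPower_succ]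
    -- Telescoping: B⊗B' - A⊗A' = (B - A)⊗B' + A⊗(B' - A'), where the primes denote n-th tensor
    -- powers.
    convert (h1.add h2).submatrix (Fin.consEquiv fun _ => Fin d).symm using 1
    ext x y
    simp [Matrix.kroneckerMap_apply]
    ring

end TensorPower

/-! ### Quadratic form estimates -/

theorem star_dotProduct_diagonal_mulVec {ι : Type*} [Fintype ι] [DecidableEq ι] (c : ι → ℝ)
    (y : ι → ℂ) : star y ⬝ᵥ Matrix.diagonal (fun i => (c i : ℂ)) *ᵥ y
      = ((∑ i, c i * ‖y i‖ ^ 2 : ℝ) : ℂ) := by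
  rw [dotProduct]
  push_cast
  refine Finset.sum_congr rfl fun i _ => ?_
  rw [Matrix.mulVec_diagonal, ← Complex.conj_mul']
  simp
  ring

theorem star_dotProduct_conjTranspose_mul_self_mulVec {ι : Type*} [Fintype ι]
    (L : Matrix ι ι ℂ) (y : ι → ℂ) :
    star y ⬝ᵥ (Lᴴ * L) *ᵥ y = ((∑ i, ‖(L *ᵥ y) i‖ ^ 2 : ℝ) : ℂ) := by
  rw [← Matrix.mulVec_mulVec, Matrix.dotProduct_mulVec, Matrix.vecMul_conjTranspose, star_star,
    dotProduct]
  push_cast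
  refine Finset.sum_congr rfl fun i _ => ?_
  rw [← Complex.conj_mul']
  simp

/-- Cauchy–Schwarz for ⟨v, Ly⟩. It allows LᴴL to be replaced by a rank-one minorant, whose tensor
powers are again rank one. -/
theorem vecMulVec_le_conjTranspose_mul_self {ι : Type*} [Fintype ι] (L : Matrix ι ι ℂ)
    {v : ι → ℂ} (hv : ∑ i, ‖v i‖ ^ 2 ≤ 1) :
    Matrix.vecMulVec (Lᴴ *ᵥ v) (star (Lᴴ *ᵥ v)) ≤ Lᴴ * L := by
  rw [Matrix.le_iff]
  refine Matrix.PosSemidef.of_dotProduct_mulVec_nonneg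
    ((Matrix.isHermitian_conjTranspose_mul_self L).sub
      (Matrix.posSemidef_vecMulVec_self_star _).isHermitian) fun y => ?_
  have h1 : star y ⬝ᵥ Matrix.vecMulVec (Lᴴ *ᵥ v) (star (Lᴴ *ᵥ v)) *ᵥ y =
      ((‖star v ⬝ᵥ L *ᵥ y‖ ^ 2 : ℝ) : ℂ) := by
    rw [Matrix.vecMulVec_mulVec, dotProduct_smul, Matrix.star_mulVec, Matrix.conjTranspose_conjTranspose,
      ← Matrix.dotProduct_mulVec]
    have : star y ⬝ᵥ Lᴴ *ᵥ v = star (star v ⬝ᵥ L *ᵥ y) := by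
      rw [Matrix.star_dotProduct, Matrix.star_mulVec, Matrix.dotProduct_mulVec, Matrix.conjTranspose_conjTranspose]
    rw [this]
    simp [Complex.conj_mul']
  rw [Matrix.sub_mulVec, dotProduct_sub, h1, star_dotProduct_conjTranspose_mul_self_mulVec,
    sub_nonneg]
  norm_cast
  exact (norm_star_dotProduct_sq_le _ _).trans (mul_le_of_le_one_left (by positivity) hv)

/-- If `u u* ≤ diag(c)` then `∑ |u i|² w i ≤ 1` whenever `w ≥ 0` and `c w ≤ 1`. -/
theorem sum_norm_sq_mul_le_of_vecMulVec_le {ι : Type*} [Fintype ι] [DecidableEq ι] {u : ι → ℂ}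
    {c w : ι → ℝ} {M : ℝ}
    (h : Matrix.vecMulVec u (star u) ≤ Matrix.diagonal fun i => (c i : ℂ)) (hw : ∀ i, 0 ≤ w i)
    (hcw : ∀ i, c i * w i ≤ M) (hM : 0 ≤ M) : ∑ i, ‖u i‖ ^ 2 * w i ≤ M := by
  -- At the vector (u_i w_i) the rank-one form equals X², where X = ∑ |u_i|² w_i, while the diagonal
  -- form is at most M·X. Hence X ≤ M.
  have h1 := (Matrix.le_iff.mp h).dotProduct_mulVec_nonneg fun i => u i * w i
  rw [Matrix.sub_mulVec, dotProduct_sub, star_dotProduct_diagonal_mulVec, sub_nonneg,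
    Matrix.vecMulVec_mulVec, dotProduct_smul] at h1
  have h2 : (star u ⬝ᵥ fun i => u i * (w i : ℂ)) = ((∑ i, ‖u i‖ ^ 2 * w i : ℝ) : ℂ) := by
    rw [dotProduct]
    push_cast
    refine Finset.sum_congr rfl fun i _ => ?_
    rw [← Complex.conj_mul']
    simp
    ring
  have h3 : (star fun i => u i * (w i : ℂ)) ⬝ᵥ u = ((∑ i, ‖u i‖ ^ 2 * w i : ℝ) : ℂ) := by
    rw [dotProduct]
    push_cast
    refine Finset.sum_congr rfl fun i _ => ?_
    rw [← Complex.conj_mul']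
    simp
    ring
  rw [h2, h3] at h1
  simp only [MulOpposite.smul_eq_mul_unop, MulOpposite.unop_op] at h1
  norm_cast at h1
  have h4 : ∑ i, c i * ‖u i * (w i : ℂ)‖ ^ 2 ≤ M * ∑ i, ‖u i‖ ^ 2 * w i := by
    rw [Finset.mul_sum]
    refine Finset.sum_le_sum fun i _ => ?_
    rw [norm_mul, Complex.norm_real, Real.norm_of_nonneg (hw i)]
    calc _ = (c i * w i) * (‖u i‖ ^ 2 * w i) := by ring
      _ ≤ _ := mul_le_mul_of_nonneg_right (hcw i) (mul_nonneg (by positivity) (hw i))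
  have h5 : 0 ≤ ∑ i, ‖u i‖ ^ 2 * w i :=
    Finset.sum_nonneg fun i _ => mul_nonneg (by positivity) (hw i)
  by_contra! hlt
  have := h1.trans h4
  nlinarith

/-- Duality: if `LᴴL ≤ diag(c)` fails for positive `c`, then `diag(c)⁻¹` is not below `1` on the
range of `Lᴴ`. -/
theorem exists_of_not_conjTranspose_mul_self_le {ι : Type*} [Fintype ι] [DecidableEq ι]
    {L : Matrix ι ι ℂ} {c : ι → ℝ} (hc : ∀ i, 0 < c i)
    (h : ¬ Lᴴ * L ≤ Matrix.diagonal fun i => (c i : ℂ)) :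
    ∃ v : ι → ℂ, ∑ i, ‖v i‖ ^ 2 < ∑ i, (c i)⁻¹ * ‖(Lᴴ *ᵥ v) i‖ ^ 2 := by
  by_contra! hcon
  apply h
  rw [Matrix.le_iff]
  refine Matrix.PosSemidef.of_dotProduct_mulVec_nonneg
    (Matrix.IsHermitian.sub (Matrix.isHermitian_diagonal_of_self_adjoint _ ?_)
      (Matrix.isHermitian_conjTranspose_mul_self L)) fun y => ?_
  · ext i; simp
  rw [Matrix.sub_mulVec, dotProduct_sub, star_dotProduct_conjTranspose_mul_self_mulVec,
    star_dotProduct_diagonal_mulVec, sub_nonneg]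
  norm_cast
  -- With v = Ly, N = |v|² = ⟨y, Lᴴv⟩. Cauchy–Schwarz with weights √c and 1/√c gives N² ≤ (∑
  -- c|y|²)(∑ c⁻¹|Lᴴv|²) ≤ (∑ c|y|²)·N.
  set v := L *ᵥ y with hv
  set N := ∑ i, ‖v i‖ ^ 2 with hN
  have h1 : star y ⬝ᵥ Lᴴ *ᵥ v = (N : ℂ) := by
    rw [← star_dotProduct_conjTranspose_mul_self_mulVec, hv, Matrix.mulVec_mulVec]
  have h2 := norm_star_dotProduct_sq_le (fun i => (Real.sqrt (c i) : ℂ) * y i)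
    (fun i => ((Real.sqrt (c i))⁻¹ : ℂ) * (Lᴴ *ᵥ v) i)
  have h3 : (star (fun i => (Real.sqrt (c i) : ℂ) * y i)) ⬝ᵥ
      (fun i => ((Real.sqrt (c i))⁻¹ : ℂ) * (Lᴴ *ᵥ v) i) = (N : ℂ) := by
    rw [← h1]
    refine Finset.sum_congr rfl fun i _ => ?_
    have : (Real.sqrt (c i) : ℂ) ≠ 0 := by
      exact_mod_cast (Real.sqrt_pos.mpr (hc i)).ne'
    simp
    field_simp
  have h4 : ∀ i, ‖(Real.sqrt (c i) : ℂ) * y i‖ ^ 2 = c i * ‖y i‖ ^ 2 := by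
    intro i
    rw [norm_mul, Complex.norm_real, Real.norm_of_nonneg (Real.sqrt_nonneg _), mul_pow,
      Real.sq_sqrt (hc i).le]
  have h5 : ∀ i, ‖((Real.sqrt (c i))⁻¹ : ℂ) * (Lᴴ *ᵥ v) i‖ ^ 2 = (c i)⁻¹ * ‖(Lᴴ *ᵥ v) i‖ ^ 2 := by
    intro i
    rw [norm_mul, norm_inv, Complex.norm_real, Real.norm_of_nonneg (Real.sqrt_nonneg _), mul_pow,
      inv_pow, Real.sq_sqrt (hc i).le]
  have hN0 : 0 ≤ N := Finset.sum_nonneg fun i _ => by positivity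
  simp only [h3, h4, h5, Complex.norm_real, Real.norm_of_nonneg hN0] at h2
  have h6 : 0 ≤ ∑ i, c i * ‖y i‖ ^ 2 :=
    Finset.sum_nonneg fun i _ => mul_nonneg (hc i).le (by positivity)
  have h7 := h2.trans (mul_le_mul_of_nonneg_left (hcon v) h6)
  by_contra! hlt
  have : 0 < N := h6.trans_lt hlt
  nlinarith

/-- For a quadratic-form valued path `t ↦ F_t` bigger than `|v|²` somewhere for all `t ∈ [0, 1]`,
there is a point where this happens and the logarithmic derivative vanishes or points outwards. -/
theorem exists_stationary_of_forall_exists {d : ℕ} (L : Matrix (Fin d) (Fin d) ℂ) (x : Fin d → ℝ)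
    (h : ∀ t ∈ Set.Icc (0 : ℝ) 1, ∃ v : Fin d → ℂ,
      ∑ i, ‖v i‖ ^ 2 < ∑ i, Real.exp (-(t * x i)) * ‖(L *ᵥ v) i‖ ^ 2) :
    ∃ t ∈ Set.Icc (0 : ℝ) 1, ∃ v : Fin d → ℂ,
      ∑ i, ‖v i‖ ^ 2 < ∑ i, Real.exp (-(t * x i)) * ‖(L *ᵥ v) i‖ ^ 2 ∧
      (1 - t) * (∑ i, Real.exp (-(t * x i)) * x i * ‖(L *ᵥ v) i‖ ^ 2) ≤ 0 ∧
      0 ≤ t * ∑ i, Real.exp (-(t * x i)) * x i * ‖(L *ᵥ v) i‖ ^ 2 := by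
  by_contra! hcon
  -- F is the excess over |v|² and m is minus its t-derivative. The sign conditions in the goal are
  -- the first-order conditions for t to minimise the convex function F(·, v) on [0,1].
  let F : ℝ → (Fin d → ℂ) → ℝ := fun t v =>
    ∑ i, Real.exp (-(t * x i)) * ‖(L *ᵥ v) i‖ ^ 2 - ∑ i, 1 * ‖v i‖ ^ 2
  let m : ℝ → (Fin d → ℂ) → ℝ := fun t v =>
    ∑ i, Real.exp (-(t * x i)) * x i * ‖(L *ᵥ v) i‖ ^ 2
  have hF : ∀ t v, 0 < F t v ↔
      ∑ i, ‖v i‖ ^ 2 < ∑ i, Real.exp (-(t * x i)) * ‖(L *ᵥ v) i‖ ^ 2 := by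
    intro t v
    simp [F]
  have hFc : ∀ v, Continuous fun t => F t v := fun v => by fun_prop
  have hmc : ∀ v, Continuous fun t => m t v := fun v => by fun_prop
  have hLin : ∀ (s r : ℝ) (a b : Fin d → ℂ), L *ᵥ (s • a + r • b) = s • (L *ᵥ a) + r • (L *ᵥ b) := by
    intro s r a b
    rw [Matrix.mulVec_add, Matrix.mulVec_smul, Matrix.mulVec_smul]
  have hm0 : ∀ t ∈ Set.Icc (0 : ℝ) 1, ∀ v, 0 < F t v → m t v ≠ 0 := by
    intro t ht v hv h0
    have := hcon t ht v ((hF t v).mp hv) (by change (1 - t) * m t v ≤ 0; rw [h0, mul_zero])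
    change t * m t v < 0 at this
    rw [h0, mul_zero] at this
    exact this.false
  -- U and V collect the t at which some vector with F > 0 has m > 0, respectively m < 0. They are
  -- open and cover [0,1]; the negated goal puts 0 in U and 1 in V. At a common point the
  -- quadratic-form lemma produces a vector with F > 0 and m = 0, which the negated goal excludes.
  let U : Set ℝ := ⋃ v, {t | 0 < F t v} ∩ {t | 0 < m t v}
  let V : Set ℝ := ⋃ v, {t | 0 < F t v} ∩ {t | m t v < 0}
  have hU : IsOpen U := isOpen_iUnion fun v =>
    (isOpen_lt continuous_const (hFc v)).inter (isOpen_lt continuous_const (hmc v))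
  have hV : IsOpen V := isOpen_iUnion fun v =>
    (isOpen_lt continuous_const (hFc v)).inter (isOpen_lt (hmc v) continuous_const)
  have hcover : Set.Icc (0 : ℝ) 1 ⊆ U ∪ V := by
    intro t ht
    obtain ⟨v, hv⟩ := h t ht
    have hv' := (hF t v).mpr hv
    rcases (hm0 t ht v hv').lt_or_gt with h1 | h1
    · exact Or.inr (Set.mem_iUnion.mpr ⟨v, hv', h1⟩)
    · exact Or.inl (Set.mem_iUnion.mpr ⟨v, hv', h1⟩)
  have hneU : (Set.Icc (0 : ℝ) 1 ∩ U).Nonempty := by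
    have h0 : (0 : ℝ) ∈ Set.Icc (0 : ℝ) 1 := by simp
    obtain ⟨v, hv⟩ := h 0 h0
    refine ⟨0, h0, Set.mem_iUnion.mpr ⟨v, (hF 0 v).mpr hv, ?_⟩⟩
    by_contra hle
    have := hcon 0 h0 v hv (by rw [sub_zero, one_mul]; exact not_lt.mp hle)
    simp at this
  have hneV : (Set.Icc (0 : ℝ) 1 ∩ V).Nonempty := by
    have h0 : (1 : ℝ) ∈ Set.Icc (0 : ℝ) 1 := by simp
    obtain ⟨v, hv⟩ := h 1 h0
    refine ⟨1, h0, Set.mem_iUnion.mpr ⟨v, (hF 1 v).mpr hv, ?_⟩⟩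
    have := hcon 1 h0 v hv (by simp)
    rwa [one_mul] at this
  obtain ⟨t, ht, htU, htV⟩ := isPreconnected_Icc U V hU hV hcover hneU hneV
  obtain ⟨a, ha₁, ha₂⟩ := Set.mem_iUnion.mp htU
  obtain ⟨b, hb₁, hb₂⟩ := Set.mem_iUnion.mp htV
  obtain ⟨v, hv₁, hv₂⟩ := exists_pos_and_eq_zero_of_quadratic (Q₁ := F t) (Q₂ := m t)
    (B₁ := fun a b => ∑ i, Real.exp (-(t * x i)) * (2 * ((L *ᵥ a) i * star ((L *ᵥ b) i)).re)
      - ∑ i, 1 * (2 * (a i * star (b i)).re))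
    (B₂ := fun a b => ∑ i, Real.exp (-(t * x i)) * x i * (2 * ((L *ᵥ a) i * star ((L *ᵥ b) i)).re))
    (fun s r a b => by
      simp only [F]
      rw [hLin, sum_mul_norm_sq_comb, sum_mul_norm_sq_comb]
      ring)
    (fun s r a b => by
      simp only [m]
      rw [hLin, sum_mul_norm_sq_comb])
    ha₁ hb₁ ha₂ hb₂
  exact hm0 t ht v hv₁ hv₂

/-! ### Testing tensor powers and Chebyshev's inequality -/

/-- The bound obtained by testing `(u u*)^{⊗ n} ≤ p diag(exp x)^{⊗ n} + q` on a suitable vector. -/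
theorem pow_mul_sum_exp_neg_abs_le {d n : ℕ} {u : Fin d → ℂ} {x : Fin d → ℝ} {p q t m : ℝ}
    (hp : 0 ≤ p) (hq : 0 ≤ q) (ht : t ∈ Set.Icc (0 : ℝ) 1) (hm₁ : (1 - t) * m ≤ 0) (hm₂ : 0 ≤ t * m)
    (h : matrixTensorPower n (Matrix.vecMulVec u (star u)) ≤
      (p : ℂ) • matrixTensorPower n (Matrix.diagonal fun i => (Real.exp (x i) : ℂ)) +
      (q : ℂ) • matrixTensorPower n 1) :
    ∑ z : Fin n → Fin d, (∏ k, Real.exp (-(t * x (z k))) * ‖u (z k)‖ ^ 2) *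
      Real.exp (-|∑ k, (x (z k) - m)|) ≤ p + q := by
  obtain ⟨ht0, ht1⟩ := ht
  have hdiag : (p : ℂ) • matrixTensorPower n (Matrix.diagonal fun i => (Real.exp (x i) : ℂ)) +
      (q : ℂ) • matrixTensorPower n 1 = Matrix.diagonal fun z : Fin n → Fin d =>
        ((p * Real.exp (∑ k, x (z k)) + q : ℝ) : ℂ) := by
    rw [matrixTensorPower_one, matrixTensorPower_diagonal, ← Matrix.diagonal_one,
      ← Matrix.diagonal_smul, ← Matrix.diagonal_smul, Matrix.diagonal_add]
    congr 1
    ext z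
    simp [Complex.exp_sum]
  rw [hdiag, matrixTensorPower_vecMulVec] at h
  -- Let S = ∑ x(z_k). The factor e^{-|S - nm|} makes both e^S w and w at most 1: by the sign
  -- conditions on m, both (1-t)S and -tS are at most |S - nm|.
  have key := sum_norm_sq_mul_le_of_vecMulVec_le (M := p + q)
    (w := fun z : Fin n → Fin d => Real.exp (-(t * ∑ k, x (z k)) - |∑ k, (x (z k) - m)|)) h
    (fun z => Real.exp_nonneg _) (fun z => ?_) (by positivity)
  · refine le_trans (le_of_eq (Finset.sum_congr rfl fun z _ => ?_)) key
    rw [Finset.prod_mul_distrib, ← Real.exp_sum, norm_prod, ← Finset.prod_pow, sub_eq_add_neg,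
      Real.exp_add, Finset.sum_neg_distrib, Finset.mul_sum]
    ring
  · have hS : ∑ k, (x (z k) - m) = ∑ k, x (z k) - n * m := by
      simp [Finset.sum_sub_distrib]
    rw [hS]
    set S := ∑ k, x (z k)
    have hn : (0 : ℝ) ≤ n := Nat.cast_nonneg n
    have h1 := le_abs_self (S - n * m)
    have h2 := neg_abs_le (S - n * m)
    have h3 := abs_nonneg (S - n * m)
    have hn1 : n * ((1 - t) * m) ≤ 0 := mul_nonpos_of_nonneg_of_nonpos hn hm₁
    have hn2 : 0 ≤ n * (t * m) := mul_nonneg hn hm₂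
    have e1 : Real.exp S * Real.exp (-(t * S) - |S - n * m|) ≤ 1 := by
      rw [← Real.exp_add, Real.exp_le_one_iff]
      nlinarith
    have e2 : Real.exp (-(t * S) - |S - n * m|) ≤ 1 := by
      rw [Real.exp_le_one_iff]
      nlinarith
    calc _ = p * (Real.exp S * Real.exp (-(t * S) - |S - n * m|))
          + q * Real.exp (-(t * S) - |S - n * m|) := by ring
      _ ≤ p * 1 + q * 1 := by gcongr
      _ = p + q := by ring

/-- Dividing the weights e^{-t x_i}|u_i|² by their sum Φ gives a probability vector c under which x
has mean m. The tested bound then reads Φ^n E[e^{-|S_n - nm|}] ≤ p_n + q_n, and deviations of order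
n have small probability. -/
theorem sum_exp_mul_norm_sq_le_one {d : ℕ} {u : Fin d → ℂ} {x : Fin d → ℝ} {p q : ℕ → ℝ} {t : ℝ}
    (hp : ∀ n, 0 ≤ p n) (hq : ∀ n, 0 ≤ q n) (ht : t ∈ Set.Icc (0 : ℝ) 1)
    (hsub : ∀ δ : ℝ, 0 < δ → ∀ᶠ n : ℕ in atTop, p n + q n ≤ Real.exp (δ * n))
    (hm₁ : (1 - t) * (∑ i, Real.exp (-(t * x i)) * x i * ‖u i‖ ^ 2) ≤ 0)
    (hm₂ : 0 ≤ t * ∑ i, Real.exp (-(t * x i)) * x i * ‖u i‖ ^ 2)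
    (h : ∀ n, 0 < n → matrixTensorPower n (Matrix.vecMulVec u (star u)) ≤
      (p n : ℂ) • matrixTensorPower n (Matrix.diagonal fun i => (Real.exp (x i) : ℂ)) +
      (q n : ℂ) • matrixTensorPower n 1) :
    ∑ i, Real.exp (-(t * x i)) * ‖u i‖ ^ 2 ≤ 1 := by
  by_contra! hΦ
  set Φ := ∑ i, Real.exp (-(t * x i)) * ‖u i‖ ^ 2 with hΦdef
  have hΦ0 : 0 < Φ := by linarith
  set m := Φ⁻¹ * ∑ i, Real.exp (-(t * x i)) * x i * ‖u i‖ ^ 2 with hmdef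
  set c : Fin d → ℝ := fun i => Φ⁻¹ * (Real.exp (-(t * x i)) * ‖u i‖ ^ 2) with hcdef
  have hc0 : ∀ i, 0 ≤ c i := fun i => by positivity
  have hc : ∑ i, c i = 1 := by
    rw [hcdef, ← Finset.mul_sum, ← hΦdef, inv_mul_cancel₀ hΦ0.ne']
  have hs : ∑ i, c i * (x i - m) = 0 := by
    simp only [mul_sub, Finset.sum_sub_distrib]
    rw [← Finset.sum_mul, hc, one_mul, hmdef, Finset.mul_sum, sub_eq_zero]
    exact Finset.sum_congr rfl fun i _ => by simp only [c]; ring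
  have hm₁' : (1 - t) * m ≤ 0 := by
    rw [hmdef, mul_left_comm]
    exact mul_nonpos_of_nonneg_of_nonpos (by positivity) hm₁
  have hm₂' : 0 ≤ t * m := by
    rw [hmdef, mul_left_comm]
    positivity
  obtain ⟨δ, hδ, hΦδ⟩ : ∃ δ, 0 < δ ∧ Φ = Real.exp δ :=
    ⟨Real.log Φ, Real.log_pos hΦ, (Real.exp_log hΦ0).symm⟩
  set V := ∑ i, c i * (x i - m) ^ 2
  have hlim : Tendsto (fun n : ℕ => 16 * V / δ ^ 2 / (n : ℝ)) atTop (𝓝 0) :=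
    tendsto_const_div_atTop_nhds_zero_nat _
  have hlim2 : Tendsto (fun n : ℕ => δ / 2 * (n : ℝ)) atTop atTop :=
    tendsto_natCast_atTop_atTop.const_mul_atTop (by positivity)
  -- With Φ = e^δ, a deviation radius δn/4 and a growth allowance e^{δn/4} leave a factor e^{δn/2}
  -- on the left, enough to beat the 1/2 from Chebyshev.
  obtain ⟨n, h1, h2, h3, hn⟩ := ((hlim.eventually_lt_const (u := 1 / 2) (by norm_num)).and
    ((hlim2.eventually_gt_atTop 1).and ((hsub (δ / 4) (by positivity)).and
      (eventually_gt_atTop 0)))).exists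
  have hn' : (0 : ℝ) < n := by exact_mod_cast hn
  have hb := pow_mul_sum_exp_neg_abs_le (hp n) (hq n) ht hm₁' hm₂' (h n hn)
  have hl := sum_prod_pi_mul_exp_neg_abs_ge hc0 hc hs n (r := δ / 4 * n) (by positivity)
  have hprod : ∀ z : Fin n → Fin d, (∏ k, Real.exp (-(t * x (z k))) * ‖u (z k)‖ ^ 2) =
      Real.exp (δ * n) * ∏ k, c (z k) := by
    intro z
    have : ∀ k, Real.exp (-(t * x (z k))) * ‖u (z k)‖ ^ 2 = Φ * c (z k) := fun k => by
      simp only [c]; field_simp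
    simp only [this, Finset.prod_mul_distrib]
    rw [Finset.prod_const, Finset.card_univ, Fintype.card_fin, hΦδ, ← Real.exp_nat_mul, mul_comm δ]
  simp only [hprod, mul_assoc] at hb
  rw [← Finset.mul_sum] at hb
  have hV : n * V / (δ / 4 * n) ^ 2 = 16 * V / δ ^ 2 / n := by
    field_simp
    norm_num
  rw [hV] at hl
  have h4 : Real.exp (-(δ / 4 * n)) * (1 / 2) ≤ Real.exp (-(δ / 4 * n)) *
      (1 - 16 * V / δ ^ 2 / n) := by
    gcongr
    linarith
  have h5 := (mul_le_mul_of_nonneg_left (h4.trans hl) (Real.exp_nonneg (δ * n))).trans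
    (hb.trans h3)
  have h6 : Real.exp (δ * n) * (Real.exp (-(δ / 4 * n)) * (1 / 2)) =
      Real.exp (δ / 4 * n) * (Real.exp (δ / 2 * n) / 2) := by
    rw [← mul_assoc, ← Real.exp_add, show δ * n + -(δ / 4 * n) = δ / 4 * n + δ / 2 * n by ring,
      Real.exp_add]
    ring
  rw [h6] at h5
  have h7 : 2 < Real.exp (δ / 2 * n) := by
    have := Real.add_one_lt_exp (x := δ / 2 * n) (by positivity)
    linarith
  have h8 := Real.exp_pos (δ / 4 * n)
  nlinarith

/-- A positive semidefinite `K` with `K^{⊗ n} ≤ pₙ diag(exp x)^{⊗ n} + qₙ` for subexponential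
`pₙ + qₙ` is bounded by some power `diag(exp x)^t`, `t ∈ [0, 1]`. -/
theorem exists_le_diagonal_exp {d : ℕ} {K : Matrix (Fin d) (Fin d) ℂ} (hK : 0 ≤ K) {x : Fin d → ℝ}
    {p q : ℕ → ℝ} (hp : ∀ n, 0 ≤ p n) (hq : ∀ n, 0 ≤ q n)
    (hsub : ∀ δ : ℝ, 0 < δ → ∀ᶠ n : ℕ in atTop, p n + q n ≤ Real.exp (δ * n))
    (h : ∀ n, 0 < n → matrixTensorPower n K ≤
      (p n : ℂ) • matrixTensorPower n (Matrix.diagonal fun i => (Real.exp (x i) : ℂ)) +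
      (q n : ℂ) • matrixTensorPower n 1) :
    ∃ t ∈ Set.Icc (0 : ℝ) 1, K ≤ Matrix.diagonal fun i => (Real.exp (t * x i) : ℂ) := by
  obtain ⟨L, rfl⟩ := CStarAlgebra.nonneg_iff_eq_star_mul_self.mp hK
  rw [Matrix.star_eq_conjTranspose] at *
  by_contra! hcon
  obtain ⟨t, ht, v, hv, hm₁, hm₂⟩ := exists_stationary_of_forall_exists Lᴴ x fun t ht => by
    obtain ⟨v, hv⟩ := exists_of_not_conjTranspose_mul_self_le (fun i => Real.exp_pos (t * x i))
      (hcon t ht)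
    exact ⟨v, by simpa only [Real.exp_neg] using hv⟩
  set N := ∑ i, ‖v i‖ ^ 2 with hN
  have hN0 : 0 ≤ N := Finset.sum_nonneg fun i _ => by positivity
  have hNpos : 0 < N := by
    refine hN0.lt_of_ne fun h0 => ?_
    have hv0 : v = 0 := by
      ext i
      have := (Finset.sum_eq_zero_iff_of_nonneg fun i _ => by positivity).mp h0.symm i
        (Finset.mem_univ i)
      simpa using this
    rw [hv0, ← h0] at hv
    simp at hv
  set v' : Fin d → ℂ := (((Real.sqrt N)⁻¹ : ℝ) : ℂ) • v with hv'
  have hsc : ∀ i (M : Matrix (Fin d) (Fin d) ℂ), ‖(M *ᵥ v') i‖ ^ 2 = N⁻¹ * ‖(M *ᵥ v) i‖ ^ 2 := by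
    intro i M
    rw [hv', Matrix.mulVec_smul, Pi.smul_apply, norm_smul, Complex.norm_real, mul_pow, Real.norm_eq_abs,
      sq_abs, inv_pow, Real.sq_sqrt hN0]
  have hv'N : ∑ i, ‖v' i‖ ^ 2 ≤ 1 := by
    have := fun i => hsc i 1
    simp only [Matrix.one_mulVec] at this
    simp only [this]
    rw [← Finset.mul_sum, inv_mul_cancel₀ hNpos.ne']
  have hfac : ∀ f : Fin d → ℝ, ∑ i, f i * ‖(Lᴴ *ᵥ v') i‖ ^ 2 =
      N⁻¹ * ∑ i, f i * ‖(Lᴴ *ᵥ v) i‖ ^ 2 := by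
    intro f
    rw [Finset.mul_sum]
    exact Finset.sum_congr rfl fun i _ => by rw [hsc]; ring
  have hle := sum_exp_mul_norm_sq_le_one (u := Lᴴ *ᵥ v') (x := x) hp hq ht hsub
    (by
      rw [hfac, mul_left_comm]
      exact mul_nonpos_of_nonneg_of_nonpos (by positivity) hm₁)
    (by
      rw [hfac, mul_left_comm]
      positivity)
    (fun n hn => (matrixTensorPower_mono n
      (Matrix.nonneg_iff_posSemidef.mpr (Matrix.posSemidef_vecMulVec_self_star _))
      (vecMulVec_le_conjTranspose_mul_self L hv'N)).trans (h n hn))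
  rw [hfac, inv_mul_le_iff₀ hNpos, mul_one] at hle
  exact absurd hv hle.not_gt

/-! ### Powers of matrices -/

section Powers

variable {ι κ : Type*} [Fintype ι] [DecidableEq ι] [Fintype κ] [DecidableEq κ]

theorem rpow_eq_cfc_of_nonneg {X : Matrix ι ι ℂ} (hX : 0 ≤ X) (s : ℝ) :
    X ^ s = cfc (fun x : ℝ => x ^ s) X := CFC.rpow_eq_cfc_real

theorem conjTranspose_rpow (X : Matrix ι ι ℂ) (s : ℝ) : (X ^ s)ᴴ = X ^ s :=
  (IsSelfAdjoint.of_nonneg (CFC.rpow_nonneg (a := X) (y := s))).star_eq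

theorem exists_rpow_eq_diagonal_exp {X : Matrix ι ι ℂ} (hX : X.PosDef) :
    ∃ (U : Matrix ι ι ℂ) (x : ι → ℝ), Uᴴ * U = 1 ∧ U * Uᴴ = 1 ∧
      (X = U * Matrix.diagonal (fun i => (Real.exp (x i) : ℂ)) * Uᴴ) ∧
      ∀ t : ℝ, X ^ t = U * Matrix.diagonal (fun i => (Real.exp (t * x i) : ℂ)) * Uᴴ := by
  have hpow : ∀ t : ℝ, X ^ t = (hX.isHermitian.eigenvectorUnitary : Matrix ι ι ℂ) *
      Matrix.diagonal (fun i => (Real.exp (t * Real.log (hX.isHermitian.eigenvalues i)) : ℂ)) *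
      (hX.isHermitian.eigenvectorUnitary : Matrix ι ι ℂ)ᴴ := by
    intro t
    rw [rpow_eq_cfc_of_nonneg hX.posSemidef.nonneg, hX.isHermitian.cfc_eq, Matrix.IsHermitian.cfc,
      Unitary.conjStarAlgAut_apply]
    congr 3
    ext i
    rw [mul_comm t, Real.exp_mul, Real.exp_log (hX.eigenvalues_pos i)]
    rfl
  refine ⟨_, fun i => Real.log (hX.isHermitian.eigenvalues i),
    Unitary.coe_star_mul_self hX.isHermitian.eigenvectorUnitary,
    Unitary.coe_mul_star_self hX.isHermitian.eigenvectorUnitary, ?_, hpow⟩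
  simpa [CFC.rpow_one X hX.posSemidef.nonneg] using hpow 1

theorem pow_mul_eq_mul_pow_of_mul_eq_mul {A : Matrix ι ι ℂ} {A' : Matrix κ κ ℂ}
    {V : Matrix ι κ ℂ} (h : A * V = V * A') (n : ℕ) : A ^ n * V = V * A' ^ n := by
  induction n with
  | zero => simp
  | succ n ih => rw [pow_succ, Matrix.mul_assoc, h, ← Matrix.mul_assoc, ih, Matrix.mul_assoc, pow_succ]

/-- Operators intertwining two self-adjoint matrices intertwine their functional calculi. -/
theorem cfc_mul_eq_mul_cfc_of_mul_eq_mul {A : Matrix ι ι ℂ} {A' : Matrix κ κ ℂ}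
    (hA : IsSelfAdjoint A) (hA' : IsSelfAdjoint A')
    {V : Matrix ι κ ℂ} (h : A * V = V * A') (f : ℝ → ℝ) : cfc f A * V = V * cfc f A' := by
  classical
  -- On the finite union of both spectra f agrees with a Lagrange interpolation polynomial, and
  -- intertwining passes to polynomials.
  let s : Finset ℝ := (Matrix.finite_real_spectrum (A := A)).toFinset ∪
    (Matrix.finite_real_spectrum (A := A')).toFinset
  let P : Polynomial ℝ := Lagrange.interpolate s id f
  have hP : ∀ x ∈ s, P.eval x = f x := fun x hx =>
    Lagrange.eval_interpolate_at_node (v := id) f (Set.injOn_id _) hx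
  have h1 : cfc f A = Polynomial.aeval A P := by
    rw [← cfc_polynomial P A hA]
    exact cfc_congr fun x hx => (hP x (by simp [s, hx])).symm
  have h2 : cfc f A' = Polynomial.aeval A' P := by
    rw [← cfc_polynomial P A' hA']
    exact cfc_congr fun x hx => (hP x (by simp [s, hx])).symm
  rw [h1, h2, Polynomial.aeval_eq_sum_range, Polynomial.aeval_eq_sum_range, Matrix.sum_mul,
    Matrix.mul_sum]
  exact Finset.sum_congr rfl fun n _ => by
    rw [Matrix.smul_mul, Matrix.mul_smul, pow_mul_eq_mul_pow_of_mul_eq_mul h]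

theorem rpow_mul_eq_mul_rpow_of_mul_eq_mul {A : Matrix ι ι ℂ} {A' : Matrix κ κ ℂ}
    (hA : 0 ≤ A) (hA' : 0 ≤ A') {V : Matrix ι κ ℂ} (h : A * V = V * A') (s : ℝ) :
    A ^ s * V = V * A' ^ s := by
  rw [rpow_eq_cfc_of_nonneg hA, rpow_eq_cfc_of_nonneg hA']
  exact cfc_mul_eq_mul_cfc_of_mul_eq_mul (.of_nonneg hA) (.of_nonneg hA') h _

theorem rpow_conjugate_nonneg {A : Matrix ι ι ℂ} (hA : 0 ≤ A) (B : Matrix ι ι ℂ) (s : ℝ) :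
    0 ≤ B ^ s * A * B ^ s := by
  have := (Matrix.nonneg_iff_posSemidef.mp hA).conjTranspose_mul_mul_same (B ^ s)
  rw [conjTranspose_rpow] at this
  exact this.nonneg

/-- V may be rectangular: with V the inclusion of a summand, this computes the mean of a direct sum
blockwise. -/
theorem operatorPerspectiveRpow_mul_eq_mul {A B : Matrix ι ι ℂ} {A' B' : Matrix κ κ ℂ}
    (hA : 0 ≤ A) (hB : 0 ≤ B) (hA' : 0 ≤ A') (hB' : 0 ≤ B') {V : Matrix ι κ ℂ}
    (h : A * V = V * A') (h' : B * V = V * B') (t : ℝ) :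
    operatorPerspectiveRpow t A B * V = V * operatorPerspectiveRpow t A' B' := by
  have hm := fun s => rpow_mul_eq_mul_rpow_of_mul_eq_mul hB hB' h' s
  have hX : B ^ (-1 / 2 : ℝ) * A * B ^ (-1 / 2 : ℝ) * V =
      V * (B' ^ (-1 / 2 : ℝ) * A' * B' ^ (-1 / 2 : ℝ)) := by
    rw [Matrix.mul_assoc, hm, ← Matrix.mul_assoc, Matrix.mul_assoc _ A, h, ← Matrix.mul_assoc, hm]
    simp only [Matrix.mul_assoc]
  have hX' := rpow_mul_eq_mul_rpow_of_mul_eq_mul (rpow_conjugate_nonneg hA B _)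
    (rpow_conjugate_nonneg hA' B' _) hX t
  unfold operatorPerspectiveRpow
  rw [Matrix.mul_assoc, hm, ← Matrix.mul_assoc, Matrix.mul_assoc _ _ V, hX', ← Matrix.mul_assoc, hm]
  simp only [Matrix.mul_assoc]

theorem mul_rpow_half_neg_half {X : Matrix ι ι ℂ} (hX : X.PosDef) :
    X ^ (1 / 2 : ℝ) * X ^ (-1 / 2 : ℝ) = 1 := by
  rw [← CFC.rpow_add hX.isUnit, show (1 / 2 + -1 / 2 : ℝ) = 0 by norm_num,
    CFC.rpow_zero X hX.posSemidef.nonneg]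

theorem rpow_half_mul_rpow_half {X : Matrix ι ι ℂ} (hX : X.PosDef) :
    X ^ (1 / 2 : ℝ) * X ^ (1 / 2 : ℝ) = X := by
  rw [← CFC.rpow_add hX.isUnit, show (1 / 2 + 1 / 2 : ℝ) = 1 by norm_num,
    CFC.rpow_one X hX.posSemidef.nonneg]

/-- Simultaneous diagonalization of a pair of positive definite matrices by a congruence. -/
theorem exists_operatorPerspectiveRpow_eq {A B : Matrix ι ι ℂ} (hA : A.PosDef) (hB : B.PosDef) :
    ∃ (W Z : Matrix ι ι ℂ) (x : ι → ℝ), W * Z = 1 ∧ Z * W = 1 ∧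
      A = W * Matrix.diagonal (fun i => (Real.exp (x i) : ℂ)) * Wᴴ ∧ B = W * Wᴴ ∧
      ∀ t : ℝ, operatorPerspectiveRpow t A B =
        W * Matrix.diagonal (fun i => (Real.exp (t * x i) : ℂ)) * Wᴴ := by
  set b := B ^ (1 / 2 : ℝ) with hb
  set b' := B ^ (-1 / 2 : ℝ) with hb'
  have hbH : bᴴ = b := conjTranspose_rpow B _
  have hb'H : b'ᴴ = b' := conjTranspose_rpow B _
  have bb' : b * b' = 1 := mul_rpow_half_neg_half hB
  have b'b : b' * b = 1 := mul_eq_one_comm.mp bb'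
  have bB : b * b = B := rpow_half_mul_rpow_half hB
  have hX : (b' * A * b').PosDef := by
    rw [(Matrix.nonneg_iff_posSemidef.mp (rpow_conjugate_nonneg hA.posSemidef.nonneg B
      _)).posDef_iff_isUnit]
    have : IsUnit b' := .of_mul_eq_one _ b'b
    exact (this.mul hA.isUnit).mul this
  obtain ⟨U, x, hU, hU', hXU, hXt⟩ := exists_rpow_eq_diagonal_exp hX
  have hWH : (b * U)ᴴ = Uᴴ * b := by rw [Matrix.conjTranspose_mul, hbH]
  -- U diagonalises B^{-1/2} A B^{-1/2}; absorbing B^{1/2} into it gives W.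
  refine ⟨b * U, Uᴴ * b', x, ?_, ?_, ?_, ?_, fun t => ?_⟩
  · rw [show b * U * (Uᴴ * b') = b * (U * Uᴴ) * b' by simp only [mul_assoc], hU', mul_one, bb']
  · rw [show Uᴴ * b' * (b * U) = Uᴴ * (b' * b) * U by simp only [mul_assoc], b'b, mul_one, hU]
  · calc A = (b * b') * A * (b' * b) := by rw [bb', b'b, one_mul, mul_one]
      _ = b * (b' * A * b') * b := by simp only [mul_assoc]
      _ = _ := by rw [hXU, hWH]; simp only [mul_assoc]
  · rw [hWH, show b * U * (Uᴴ * b) = b * (U * Uᴴ) * b by simp only [mul_assoc], hU', mul_one, bB]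
  · rw [operatorPerspectiveRpow, ← hb, ← hb', hXt, hWH]
    simp only [mul_assoc]

end Powers

/-! ### Order and topology -/

theorem conjugate_le_conjugate_of_le {ι κ : Type*} [Fintype ι] [Fintype κ] {X Y : Matrix ι ι ℂ} (h : X ≤ Y)
    (W : Matrix κ ι ℂ) : W * X * Wᴴ ≤ W * Y * Wᴴ := by
  have := (Matrix.le_iff.mp h).mul_mul_conjTranspose_same W
  rw [Matrix.mul_sub, Matrix.sub_mul] at this
  exact this

theorem posDef_add_smul_one {ι : Type*} [DecidableEq ι] {X : Matrix ι ι ℂ} (hX : X.PosSemidef) {ε : ℝ} (hε : 0 < ε) :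
    (X + (ε : ℂ) • (1 : Matrix ι ι ℂ)).PosDef :=
  (Matrix.PosDef.one.smul (by exact_mod_cast hε : (0 : ℂ) < ε)).posSemidef_add hX

theorem add_smul_one_le {ι : Type*} [DecidableEq ι] (X : Matrix ι ι ℂ) {u v : ℝ} (huv : u ≤ v) :
    X + (u : ℂ) • (1 : Matrix ι ι ℂ) ≤ X + (v : ℂ) • (1 : Matrix ι ι ℂ) := by
  rw [Matrix.le_iff, add_sub_add_left_eq_sub, ← sub_smul]
  exact Matrix.PosSemidef.one.smul (by exact_mod_cast sub_nonneg.mpr huv)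

section OrderTopology

variable {ι : Type*} [Fintype ι] [DecidableEq ι]

open scoped Matrix.Norms.L2Operator in
-- Closedness of the Löwner order comes from the C*-structure of the operator norm, whose instances
-- are scoped; recording it makes it usable outside that scope.
theorem matrix_orderClosedTopology : OrderClosedTopology (Matrix ι ι ℂ) := inferInstance

theorem continuous_operatorPerspectiveRpow {A B : Matrix ι ι ℂ} (hA : A.PosDef) (hB : B.PosDef) :
    Continuous fun t : ℝ => operatorPerspectiveRpow t A B := by
  obtain ⟨W, Z, x, -, -, -, -, h⟩ := exists_operatorPerspectiveRpow_eq hA hB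
  simp only [h]
  have hd : Continuous fun (t : ℝ) (i : ι) => (Real.exp (t * x i) : ℂ) := by fun_prop
  exact (continuous_const.matrix_mul hd.matrix_diagonal).matrix_mul continuous_const

theorem isClosed_setOf_le_operatorPerspectiveRpow {A B C : Matrix ι ι ℂ} (hA : A.PosDef)
    (hB : B.PosDef) : IsClosed {t : ℝ | C ≤ operatorPerspectiveRpow t A B} := by
  have := matrix_orderClosedTopology (ι := ι)
  exact isClosed_le continuous_const (continuous_operatorPerspectiveRpow hA hB)

end OrderTopology

/-! ### A single pair of operators -/

/-- Congruence by the tensor power of Z carries the bounds to the pair (diag(e^x), 1); congruence by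
W carries the conclusion back. -/
theorem exists_le_operatorPerspectiveRpow_of_posDef {d : ℕ} {A B C : Matrix (Fin d) (Fin d) ℂ}
    (hA : A.PosDef) (hB : B.PosDef) (hC : 0 ≤ C) {p q : ℕ → ℝ} (hp : ∀ n, 0 ≤ p n)
    (hq : ∀ n, 0 ≤ q n)
    (hsub : ∀ δ : ℝ, 0 < δ → ∀ᶠ n : ℕ in atTop, p n + q n ≤ Real.exp (δ * n))
    (h : ∀ n, 0 < n → matrixTensorPower n C ≤
      (p n : ℂ) • matrixTensorPower n A + (q n : ℂ) • matrixTensorPower n B) :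
    ∃ t ∈ Set.Icc (0 : ℝ) 1, C ≤ operatorPerspectiveRpow t A B := by
  obtain ⟨W, Z, x, hWZ, hZW, hAW, hBW, hpersp⟩ := exists_operatorPerspectiveRpow_eq hA hB
  have hZW' : Wᴴ * Zᴴ = 1 := by rw [← Matrix.conjTranspose_mul, hZW, Matrix.conjTranspose_one]
  have hWZ' : Zᴴ * Wᴴ = 1 := mul_eq_one_comm.mp hZW'
  have hcancel : ∀ M, Z * (W * M * Wᴴ) * Zᴴ = M := fun M => by
    rw [show Z * (W * M * Wᴴ) * Zᴴ = (Z * W) * M * (Wᴴ * Zᴴ) by simp only [mul_assoc], hZW, hZW',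
      one_mul, mul_one]
  have hZA := hcancel (Matrix.diagonal fun i => (Real.exp (x i) : ℂ))
  rw [← hAW] at hZA
  have hZB := hcancel 1
  rw [mul_one, ← hBW] at hZB
  obtain ⟨t, ht, hle⟩ := exists_le_diagonal_exp (K := Z * C * Zᴴ)
    ((Matrix.nonneg_iff_posSemidef.mp hC).mul_mul_conjTranspose_same Z).nonneg (x := x) hp hq hsub
    (fun n hn => by
      have := conjugate_le_conjugate_of_le (h n hn) (matrixTensorPower n Z)
      simp only [mul_add, add_mul, mul_smul_comm, smul_mul_assoc, ← matrixTensorPower_conjTranspose,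
        ← matrixTensorPower_mul, hZA, hZB] at this
      exact this)
  refine ⟨t, ht, ?_⟩
  rw [hpersp]
  have h2 := conjugate_le_conjugate_of_le hle W
  rwa [show W * (Z * C * Zᴴ) * Wᴴ = (W * Z) * C * (Zᴴ * Wᴴ) by simp only [mul_assoc], hWZ, hWZ',
    one_mul, mul_one] at h2

theorem exists_forall_le_operatorPerspectiveRpow {d : ℕ} {A B C : Matrix (Fin d) (Fin d) ℂ}
    (hA : A.PosSemidef) (hB : B.PosSemidef) (hC : 0 ≤ C) {p q : ℕ → ℝ} (hp : ∀ n, 0 ≤ p n)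
    (hq : ∀ n, 0 ≤ q n)
    (hsub : ∀ δ : ℝ, 0 < δ → ∀ᶠ n : ℕ in atTop, p n + q n ≤ Real.exp (δ * n))
    (h : ∀ n, 0 < n → matrixTensorPower n C ≤
      (p n : ℂ) • matrixTensorPower n A + (q n : ℂ) • matrixTensorPower n B) :
    ∃ t ∈ Set.Icc (0 : ℝ) 1, ∀ ε : ℝ, 0 < ε →
      C ≤ operatorPerspectiveRpow t (A + (ε : ℂ) • 1) (B + (ε : ℂ) • 1) := by
  -- The admissible exponents at level ε form closed sets that shrink with ε. Each is nonempty
  -- because adding ε only enlarges the tensor powers on the right, so compactness yields an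
  -- exponent common to all ε.
  let T : Set.Ioi (0 : ℝ) → Set ℝ := fun ε => Set.Icc (0 : ℝ) 1 ∩
    {t | C ≤ operatorPerspectiveRpow t (A + ((ε : ℝ) : ℂ) • 1) (B + ((ε : ℝ) : ℂ) • 1)}
  have hclosed : ∀ ε, IsClosed (T ε) := fun ε => isClosed_Icc.inter
    (isClosed_setOf_le_operatorPerspectiveRpow (posDef_add_smul_one hA ε.2)
      (posDef_add_smul_one hB ε.2))
  have hmono : ∀ ε ε' : Set.Ioi (0 : ℝ), (ε : ℝ) ≤ ε' → T ε ⊆ T ε' := fun ε ε' hε t ht =>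
    ⟨ht.1, ht.2.trans (operatorPerspectiveRpow_mono ht.1 (posDef_add_smul_one hA ε'.2)
      (posDef_add_smul_one hB ε.2) (posDef_add_smul_one hB ε'.2) (add_smul_one_le A hε)
      (add_smul_one_le B hε))⟩
  have hle : ∀ {X : Matrix (Fin d) (Fin d) ℂ} {ε : ℝ}, 0 < ε → X ≤ X + (ε : ℂ) • 1 := by
    intro X ε hε
    simpa using add_smul_one_le X hε.le
  have hne : ∀ ε, (T ε).Nonempty := by
    intro ε
    obtain ⟨t, ht, htC⟩ := exists_le_operatorPerspectiveRpow_of_posDef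
      (posDef_add_smul_one hA ε.2) (posDef_add_smul_one hB ε.2) hC hp hq hsub fun n hn =>
        (h n hn).trans (add_le_add
          (smul_le_smul_of_nonneg_left (matrixTensorPower_mono n hA.nonneg (hle ε.2))
            (by exact_mod_cast hp n))
          (smul_le_smul_of_nonneg_left (matrixTensorPower_mono n hB.nonneg (hle ε.2))
            (by exact_mod_cast hq n)))
    exact ⟨t, ht, htC⟩
  have : Nonempty (Set.Ioi (0 : ℝ)) := ⟨⟨1, Set.mem_Ioi.mpr one_pos⟩⟩
  obtain ⟨t, ht⟩ := IsCompact.nonempty_iInter_of_directed_nonempty_isCompact_isClosed T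
    (fun ε ε' => by
      rcases le_total (ε : ℝ) ε' with h | h
      · exact ⟨ε, subset_rfl, hmono _ _ h⟩
      · exact ⟨ε', hmono _ _ h, subset_rfl⟩)
    hne (fun ε => isCompact_Icc.of_isClosed_subset (hclosed ε) Set.inter_subset_left) hclosed
  rw [Set.mem_iInter] at ht
  exact ⟨t, (ht ⟨1, Set.mem_Ioi.mpr one_pos⟩).1, fun ε hε => (ht ⟨ε, hε⟩).2⟩

theorem le_kuboAndoMean_of_forall_le {ι : Type*} [Fintype ι] [DecidableEq ι]
    {A B C : Matrix ι ι ℂ} {t : ℝ} (ht : t ∈ Set.Icc (0 : ℝ) 1) (hA : A.PosSemidef)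
    (hB : B.PosSemidef)
    (h : ∀ ε : ℝ, 0 < ε → C ≤ operatorPerspectiveRpow t (A + (ε : ℂ) • 1) (B + (ε : ℂ) • 1)) :
    C ≤ kuboAndoMean t B A := by
  have := matrix_orderClosedTopology (ι := ι)
  refine ge_of_tendsto (tendsto_kuboAndoMean ht hA hB) ?_
  filter_upwards [self_mem_nhdsWithin] with ε hε using h ε hε

/-! ### Direct sums -/

section DirectSum

variable {r : ℕ} {d : Fin r → ℕ}

/-- The inclusion of the `i`-th summand into a direct sum. -/
def directSumInclusion (d : Fin r → ℕ) (i : Fin r) : Matrix (Fin (∑ i, d i)) (Fin (d i)) ℂ :=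
  (1 : Matrix (Fin (∑ i, d i)) (Fin (∑ i, d i)) ℂ).submatrix id fun k => finSigmaFinEquiv ⟨i, k⟩

theorem mul_directSumInclusion_apply (i : Fin r)
    (M : Matrix (Fin (∑ i, d i)) (Fin (∑ i, d i)) ℂ) (k : Fin (∑ i, d i)) (l : Fin (d i)) :
    (M * directSumInclusion d i) k l = M k (finSigmaFinEquiv ⟨i, l⟩) := by
  simp [directSumInclusion, Matrix.mul_apply, Matrix.one_apply]

theorem directSumInclusion_conjTranspose_mul_apply {κ : Type*} (i : Fin r)
    (M : Matrix (Fin (∑ i, d i)) κ ℂ) (k : Fin (d i)) (l : κ) :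
    ((directSumInclusion d i)ᴴ * M) k l = M (finSigmaFinEquiv ⟨i, k⟩) l := by
  simp [directSumInclusion, Matrix.mul_apply, Matrix.one_apply]

theorem directSumInclusion_conjTranspose_mul_self (i : Fin r) :
    (directSumInclusion d i)ᴴ * directSumInclusion d i = 1 := by
  ext k l
  rw [directSumInclusion_conjTranspose_mul_apply]
  simp [directSumInclusion, Matrix.one_apply]

theorem matrixDirectSum_mul_directSumInclusion (A : ∀ i, Matrix (Fin (d i)) (Fin (d i)) ℂ)
    (i : Fin r) : matrixDirectSum A * directSumInclusion d i = directSumInclusion d i * A i := by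
  ext k l
  obtain ⟨⟨j, k⟩, rfl⟩ := finSigmaFinEquiv.surjective k
  rw [mul_directSumInclusion_apply]
  rcases eq_or_ne j i with rfl | h
  · simp [matrixDirectSum, Matrix.mul_apply, directSumInclusion, Matrix.one_apply,
      Matrix.blockDiagonal'_apply_eq]
  · simp [matrixDirectSum, Matrix.mul_apply, directSumInclusion,
      Matrix.blockDiagonal'_apply_ne _ _ _ h, h]

/-- Compress by the isometric inclusion of the i-th summand, which intertwines the direct sums with
their blocks. -/
theorem le_operatorPerspectiveRpow_of_matrixDirectSum_le
    {A B C : ∀ i, Matrix (Fin (d i)) (Fin (d i)) ℂ} (hA : ∀ i, (A i).PosSemidef)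
    (hB : ∀ i, (B i).PosSemidef) (hA' : (matrixDirectSum A).PosSemidef)
    (hB' : (matrixDirectSum B).PosSemidef) {t ε : ℝ} (hε : 0 < ε)
    (h : matrixDirectSum C ≤ operatorPerspectiveRpow t (matrixDirectSum A + (ε : ℂ) • 1)
      (matrixDirectSum B + (ε : ℂ) • 1)) (i : Fin r) :
    C i ≤ operatorPerspectiveRpow t (A i + (ε : ℂ) • 1) (B i + (ε : ℂ) • 1) := by
  have hV := directSumInclusion_conjTranspose_mul_self (d := d) i
  have hint : ∀ X : ∀ i, Matrix (Fin (d i)) (Fin (d i)) ℂ,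
      (matrixDirectSum X + (ε : ℂ) • 1) * directSumInclusion d i =
        directSumInclusion d i * (X i + (ε : ℂ) • 1) := fun X => by
    rw [Matrix.add_mul, Matrix.mul_add, matrixDirectSum_mul_directSumInclusion, Matrix.smul_mul,
      Matrix.mul_smul, Matrix.one_mul, Matrix.mul_one]
  have hpos : ∀ {n : ℕ} {X : Matrix (Fin n) (Fin n) ℂ}, X.PosSemidef →
      0 ≤ X + (ε : ℂ) • (1 : Matrix (Fin n) (Fin n) ℂ) := fun hX =>
    (posDef_add_smul_one hX hε).posSemidef.nonneg
  have key := conjugate_le_conjugate_of_le h (directSumInclusion d i)ᴴ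
  rwa [Matrix.conjTranspose_conjTranspose, Matrix.mul_assoc, Matrix.mul_assoc,
    matrixDirectSum_mul_directSumInclusion,
    operatorPerspectiveRpow_mul_eq_mul (hpos hA') (hpos hB') (hpos (hA i)) (hpos (hB i)) (hint A)
      (hint B), ← Matrix.mul_assoc, ← Matrix.mul_assoc, hV, Matrix.one_mul, Matrix.one_mul] at key

end DirectSum

/-! ### Positive operator functions -/

theorem eventually_le_exp_of_limsup_log_div_le {a : ℕ → ℝ≥0}
    (h : limsup (fun n : ℕ => ENNReal.log (a n : ℝ≥0∞) / ((n : ℝ) : EReal)) atTop ≤ 0)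
    {δ : ℝ} (hδ : 0 < δ) : ∀ᶠ n : ℕ in atTop, (a n : ℝ) ≤ Real.exp (δ * n) := by
  have h1 : limsup (fun n : ℕ => ENNReal.log (a n : ℝ≥0∞) / ((n : ℝ) : EReal)) atTop < (δ : EReal) :=
    h.trans_lt (by exact_mod_cast hδ)
  filter_upwards [eventually_lt_of_limsup_lt h1, eventually_gt_atTop 0] with n hn hn0
  rw [EReal.div_lt_iff (by exact_mod_cast hn0) (EReal.coe_ne_top _)] at hn
  -- At zero the extended logarithm is -∞ and has no real counterpart, so this case is separate.
  rcases eq_or_ne (a n) 0 with h0 | h0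
  · rw [h0]; positivity
  have hpos : 0 < (a n : ℝ) := by exact_mod_cast pos_iff_ne_zero.mpr h0
  have hlog : ENNReal.log (a n : ℝ≥0∞) = ((Real.log (a n) : ℝ) : EReal) := by
    rw [ENNReal.log_pos_real (by exact_mod_cast h0) ENNReal.coe_ne_top, ENNReal.coe_toReal]
  rw [hlog] at hn
  have : Real.log (a n) < δ * n := by exact_mod_cast hn
  exact ((Real.log_lt_iff_lt_exp hpos).mp this).le

namespace PositiveOperatorFunction

variable {G : PositiveOperatorFunction}

/-- The exponents for which `G(A₁, A₂) ≤ (A₂ + ε) #_t (A₁ + ε)` for all `ε > 0`. -/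
def exponents (G : PositiveOperatorFunction) {d : ℕ} (A₁ A₂ : Matrix (Fin d) (Fin d) ℂ) : Set ℝ :=
  {t | ∀ ε : ℝ, 0 < ε →
    G.val A₁ A₂ ≤ operatorPerspectiveRpow t (A₁ + (ε : ℂ) • 1) (A₂ + (ε : ℂ) • 1)}

/-- Each regularised mean is continuous in t. The mean itself may jump at an endpoint for singular
operators, as for the scalars 0 and 1, so exponents are defined through all ε > 0. -/
theorem isClosed_exponents {d : ℕ} {A₁ A₂ : Matrix (Fin d) (Fin d) ℂ} (h : (A₁, A₂) ∈ G.dom d) :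
    IsClosed (G.exponents A₁ A₂) := by
  obtain ⟨h₁, h₂⟩ := G.posSemidef_of_mem h
  simp only [exponents, Set.ofPred_forall]
  exact isClosed_iInter fun ε => isClosed_iInter fun hε =>
    isClosed_setOf_le_operatorPerspectiveRpow (posDef_add_smul_one h₁ hε)
      (posDef_add_smul_one h₂ hε)

theorem AsymptoticallyIndividuallyAMBounded.exponents_nonempty
    (hAM : G.AsymptoticallyIndividuallyAMBounded) {d : ℕ} {A₁ A₂ : Matrix (Fin d) (Fin d) ℂ}
    (h : (A₁, A₂) ∈ G.dom d) : (Set.Icc (0 : ℝ) 1 ∩ G.exponents A₁ A₂).Nonempty := by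
  obtain ⟨h₁, h₂⟩ := G.posSemidef_of_mem h
  obtain ⟨p, q, hpq, hlim⟩ := hAM d A₁ A₂ h
  obtain ⟨t, ht, hle⟩ := exists_forall_le_operatorPerspectiveRpow h₁ h₂
    (G.posSemidef_val h).nonneg (p := fun n => p n) (q := fun n => q n) (fun n => (p n).2)
    (fun n => (q n).2) (fun δ hδ => by simpa using eventually_le_exp_of_limsup_log_div_le hlim hδ) hpq
  exact ⟨t, ht, hle⟩

/-- Superadditivity puts ⨁ G(A_i, B_i) below the mean of the direct sums, and compression to a block
does the rest. -/
theorem BlockSuperadditive.exponents_matrixDirectSum_subset (hsup : G.BlockSuperadditive) {r : ℕ}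
    (hr : 0 < r) {d : Fin r → ℕ} {A B : ∀ i, Matrix (Fin (d i)) (Fin (d i)) ℂ}
    (h : ∀ i, (A i, B i) ∈ G.dom (d i)) (i : Fin r) :
    G.exponents (matrixDirectSum A) (matrixDirectSum B) ⊆ G.exponents (A i) (B i) := by
  obtain ⟨hmem, hle⟩ := hsup r hr d A B h
  intro t ht ε hε
  exact le_operatorPerspectiveRpow_of_matrixDirectSum_le (fun i => (G.posSemidef_of_mem (h i)).1)
    (fun i => (G.posSemidef_of_mem (h i)).2) (G.posSemidef_of_mem hmem).1
    (G.posSemidef_of_mem hmem).2 hε (hle.trans (ht ε hε)) i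

theorem exists_leKuboAndo (hsup : G.BlockSuperadditive)
    (hAM : G.AsymptoticallyIndividuallyAMBounded) : ∃ t ∈ Set.Icc (0 : ℝ) 1, G.LeKuboAndo t := by
  let T : (Σ d, G.dom d) → Set ℝ := fun a => G.exponents a.2.1.1 a.2.1.2
  obtain ⟨t, ht, htT⟩ := isCompact_Icc.inter_iInter_nonempty (s := Set.Icc (0 : ℝ) 1) T
    (fun a => isClosed_exponents a.2.2) fun s => by
      -- Direct sums need at least one summand, so the empty subfamily is treated apart.
      rcases s.eq_empty_or_nonempty with rfl | hs
      · exact ⟨0, by simp⟩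
      let e := s.equivFin.symm
      have hdom : ∀ i, ((e i).1.2.1.1, (e i).1.2.1.2) ∈ G.dom (e i).1.1 := fun i => (e i).1.2.2
      have hr : 0 < s.card := hs.card_pos
      obtain ⟨t, ht, htT⟩ := hAM.exponents_nonempty (hsup s.card hr _ _ _ hdom).1
      refine ⟨t, ht, Set.mem_iInter₂.mpr fun a ha => ?_⟩
      have := hsup.exponents_matrixDirectSum_subset hr hdom (e.symm ⟨a, ha⟩) htT
      change t ∈ T (e (e.symm ⟨a, ha⟩)).1 at this
      rwa [Equiv.apply_symm_apply] at this
  refine ⟨t, ht, fun d A₁ A₂ h => ?_⟩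
  obtain ⟨h₁, h₂⟩ := G.posSemidef_of_mem h
  exact le_kuboAndoMean_of_forall_le ht h₁ h₂ (Set.mem_iInter.mp htT ⟨d, (A₁, A₂), h⟩)

end PositiveOperatorFunction

/-! ### Scalars -/

section Scalar

variable {ι : Type*} [Fintype ι] [DecidableEq ι]

theorem cfc_smul_one (f : ℝ → ℝ) (a : ℝ) :
    cfc f ((a : ℂ) • (1 : Matrix ι ι ℂ)) = (f a : ℂ) • (1 : Matrix ι ι ℂ) := by
  have h : ∀ x : ℝ, (x : ℂ) • (1 : Matrix ι ι ℂ) = algebraMap ℝ (Matrix ι ι ℂ) x := fun x => by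
    rw [Algebra.algebraMap_eq_smul_one, Complex.coe_smul]
  rw [h, h, cfc_algebraMap]

theorem rpow_smul_one {a : ℝ} (ha : 0 ≤ a) (s : ℝ) :
    ((a : ℂ) • (1 : Matrix ι ι ℂ)) ^ s = ((a ^ s : ℝ) : ℂ) • (1 : Matrix ι ι ℂ) := by
  rw [rpow_eq_cfc_of_nonneg, cfc_smul_one]
  exact (Matrix.PosSemidef.one.smul (by exact_mod_cast ha : (0 : ℂ) ≤ a)).nonneg

theorem operatorPerspectiveRpow_smul_one {a b : ℝ} (ha : 0 < a) (hb : 0 < b) (t : ℝ) :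
    operatorPerspectiveRpow t ((a : ℂ) • (1 : Matrix ι ι ℂ)) ((b : ℂ) • 1) =
      ((b * (a / b) ^ t : ℝ) : ℂ) • (1 : Matrix ι ι ℂ) := by
  have h1 : b ^ (-1 / 2 : ℝ) * a * b ^ (-1 / 2 : ℝ) = a / b := by
    rw [mul_right_comm, ← Real.rpow_add hb]
    norm_num [Real.rpow_neg_one]
    ring
  have h2 : b ^ (1 / 2 : ℝ) * (a / b) ^ t * b ^ (1 / 2 : ℝ) = b * (a / b) ^ t := by
    rw [mul_right_comm, ← Real.rpow_add hb]
    norm_num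
  rw [operatorPerspectiveRpow, rpow_smul_one hb.le, rpow_smul_one hb.le]
  simp only [smul_mul_assoc, mul_smul_comm, one_mul, mul_one, smul_smul, ← Complex.ofReal_mul]
  rw [show b ^ (-1 / 2 : ℝ) * (a * b ^ (-1 / 2 : ℝ)) = a / b by rw [← h1]; ring,
    rpow_smul_one (by positivity)]
  simp only [smul_smul, ← Complex.ofReal_mul]
  rw [← h2]
  congr 2
  ring

theorem kuboAndoMean_smul_one {a b : ℝ} (ha : 0 < a) (hb : 0 < b) {t : ℝ}
    (ht : t ∈ Set.Icc (0 : ℝ) 1) :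
    kuboAndoMean t ((b : ℂ) • (1 : Matrix ι ι ℂ)) ((a : ℂ) • 1) =
      ((b * (a / b) ^ t : ℝ) : ℂ) • (1 : Matrix ι ι ℂ) := by
  have hps : ∀ {x : ℝ}, 0 < x → ((x : ℂ) • (1 : Matrix ι ι ℂ)).PosSemidef := fun hx =>
    Matrix.PosSemidef.one.smul (by exact_mod_cast hx.le)
  refine tendsto_nhds_unique (tendsto_kuboAndoMean ht (hps ha) (hps hb)) ?_
  have hreal : Tendsto (fun ε : ℝ => (b + ε) * ((a + ε) / (b + ε)) ^ t) (𝓝 0)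
      (𝓝 (b * (a / b) ^ t)) := by
    have : ContinuousAt (fun ε : ℝ => (b + ε) * ((a + ε) / (b + ε)) ^ t) 0 := by
      have hb0 : b + 0 ≠ 0 := by simpa using hb.ne'
      refine ContinuousAt.mul (by fun_prop) (ContinuousAt.rpow_const ?_ (Or.inr ht.1))
      exact ContinuousAt.div (by fun_prop) (by fun_prop) hb0
    simpa [ContinuousAt] using this
  refine Tendsto.congr' ?_ ((((Complex.continuous_ofReal.tendsto _).comp hreal).mono_left
    nhdsWithin_le_nhds).smul_const (1 : Matrix ι ι ℂ))
  filter_upwards [self_mem_nhdsWithin] with ε hε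
  have hε' : 0 < ε := hε
  rw [← add_smul, ← add_smul, ← Complex.ofReal_add, ← Complex.ofReal_add,
    operatorPerspectiveRpow_smul_one (by positivity) (by positivity)]
  rfl

end Scalar

/-! ### Identification of the exponent and the main theorem -/

theorem PositiveOperatorFunction.LeKuboAndo.eq_of_isWeightedGeometricMean
    {G : PositiveOperatorFunction} {ν₁ ν₂ t : ℝ} (hG : G.IsWeightedGeometricMean ν₁ ν₂)
    (ht : t ∈ Set.Icc (0 : ℝ) 1) (h : G.LeKuboAndo t) : t = ν₁ := by
  -- The 1×1 pair (e^y, 1) gives e^{ν₁y} ≤ e^{ty}; the choices y = 1 and y = -1 force equality.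
  have key : ∀ y : ℝ, ν₁ * y ≤ t * y := by
    intro y
    let A : Matrix (Fin 1) (Fin 1) ℂ := ((Real.exp y : ℝ) : ℂ) • 1
    let B : Matrix (Fin 1) (Fin 1) ℂ := ((1 : ℝ) : ℂ) • 1
    have hA : A.PosDef := Matrix.PosDef.one.smul (by exact_mod_cast Real.exp_pos y)
    have hB : B.PosDef := Matrix.PosDef.one.smul (by simp)
    obtain ⟨hmem, hval⟩ := hG 1 one_pos A B hA hB
      (((Commute.refl (1 : Matrix (Fin 1) (Fin 1) ℂ)).smul_left _).smul_right _)
    have hle := h 1 A B hmem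
    rw [hval, cfc_smul_one, cfc_smul_one, kuboAndoMean_smul_one (Real.exp_pos y) one_pos ht,
      Real.log_exp, Real.log_one, smul_smul, ← Matrix.diagonal_one, ← Matrix.diagonal_smul,
      ← Matrix.diagonal_smul, ← Matrix.diagonal_smul, ← Matrix.diagonal_smul, Matrix.diagonal_add,
      Matrix.exp_diagonal] at hle
    have h0 := (Matrix.le_iff.mp hle).diag_nonneg (i := 0)
    simp [← Complex.exp_eq_exp_ℂ, Pi.exp_def] at h0
    rw [← Real.exp_mul, ← Complex.ofReal_mul, ← Complex.ofReal_exp, Complex.real_le_real,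
      Real.exp_le_exp, mul_comm y] at h0
    exact h0
  have h1 := key 1
  have h2 := key (-1)
  linarith

theorem mainTheorem3 (G : PositiveOperatorFunction) (hsup : G.BlockSuperadditive)
    (hAM : G.AsymptoticallyIndividuallyAMBounded) :
    (∃ t ∈ Set.Icc (0 : ℝ) 1, G.LeKuboAndo t) ∧
    (∀ ν₁ ν₂ : ℝ, 0 ≤ ν₁ → 0 ≤ ν₂ → ν₁ + ν₂ = 1 → G.IsWeightedGeometricMean ν₁ ν₂ →
      G.LeKuboAndo ν₁ ∧ ∀ t ∈ Set.Icc (0 : ℝ) 1, G.LeKuboAndo t → t = ν₁) := by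
  obtain ⟨t, ht, hle⟩ := PositiveOperatorFunction.exists_leKuboAndo hsup hAM
  refine ⟨⟨t, ht, hle⟩, fun ν₁ ν₂ _ _ _ hG => ⟨?_, fun s hs hs' =>
    hs'.eq_of_isWeightedGeometricMean hG hs⟩⟩
  rwa [← hle.eq_of_isWeightedGeometricMean hG ht]
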